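/- **Conventions.** For $f\in L^1(\mathbb R)$ put $\hat f(\gamma)=\int_{\mathbb R} f(x)e^{-2\pi i\gamma x}\,dx$, extended to $L^2(\mathbb R)$ as usual; $(T_af)(x)=f(x-a)$. For measurable $S\subset\mathbb R$ let $\check L^2(S)=\{f\in L^2(\mathbb R): \operatorname{supp}\hat f\subset S\}$, i.e. $\hat f=0$ a.e. outside $S$. Supports and statements about the values of $\hat f$ are understood up to null sets. A family $\{f_\ell\}$ in a closed subspace $V\subset L^2(\mathbb R)$ is a frame for $V$ if $A\|f\|^2\le\sum_\ell|\langle f,f_\ell\rangle|^2\le B\|f\|^2$ for all $f\in V$ with some constants $0<A\le B<\infty$; two frames $\{f_\ell\},\{\tilde f_\ell\}$ for $V$ are dual frames for $V$ if $f=\sum_\ell\langle f,f_\ell\rangle\tilde f_\ell=\sum_\ell\langle f,\tilde f_\ell\rangle f_\ell$ for all $f\in V$. **Setup.** Let $J$ be an at most countable index set and $N\ge 1$ an integer. (I) Let $S=\bigcup_{i\in I}S_i$ with $I\subset\mathbb Z$, where the $S_i=(\alpha_i,\beta_i]$ are nonempty intervals ($\alpha_i=-\infty$ and $\beta_i=\infty$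 are allowed; if $\beta_i=\infty$, then $S_i=(\alpha_i,\infty)$) with $\beta_i\le\alpha_{i'}$ whenever $i<i'$. For each $i\in I$ let $\{\xi^{(i)}_k\}_{k\in\mathbb Z}\subset S_i$ be a sequence of knots with $\xi^{(i)}_k\le\xi^{(i)}_{k+1}$, $\lim_{k\to-\infty}\xi^{(i)}_k=\alpha_i$ and $\lim_{k\to\infty}\xi^{(i)}_k=\beta_i$. (II) For each $j\in J$ let $c_j>0$ and $g_j\in L^2(\mathbb R)$ be such that $\hat g_j$ is a bounded real function whose support is compact and contained in a finite union of the sets $S_i$; assume $\sup_j\|c_j^{-1/2}\hat g_j\|_\infty<\infty$. (III) For $j\in J$ let $I_j=\{i\in I:\hat g_j\ne0\text{ on }S_i\}$, where "$\hat g_j\neq 0$ on $S_i$" means that $\hat g_j$ does not vanish a.e. on $S_i$. For each $i\in I$ let $J_i\subset J$ be a set with $\{j\in J: i\in I_j\}\subset J_i$, and let $\varphi_i:J_i\to\mathbb Z$ be a bijection, such that for every $j\in J$ $$\operatorname{supp}\hat g_j\subset\bigcup_{i\in I_j}\bigl[\xi^{(i)}_{\varphi_i(j)},\,\xi^{(i)}_{\varphi_i(j)+N}\bigr].$$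 (IV) Let $\{a^{(i)}_{k,n}\}_{i\in I,\,k\in\mathbb Z,\,n\in\{-N+1,\dots,N-1\}}$ be complex numbers and let $h_j\in\check L^2(S)$, $j\in J$, be given by $$\hat h_j(\gamma)=\sum_{n=-N+1}^{N-1}a^{(i)}_{\varphi_i(j),n}\,\hat g_{\varphi_i^{-1}(\varphi_i(j)+n)}(\gamma)\quad(\gamma\in S_i,\ i\in I_j),\qquad \hat h_j(\gamma)=0\quad(\gamma\in S_i,\ i\notin I_j).$$ **Theorem.** Assume the setup (I)–(IV). Suppose that $$\sum_{j\in J}c_j^{-1/2}\hat g_j(\gamma)=\chi_S(\gamma)\quad\text{for a.e. }\gamma\in\mathbb R,$$ that for every $j\in J$ with $I_j\neq\emptyset$ we have $c_j\le1/M_j$, where, with $p=\min I_j$ and $q=\max I_j$, $$M_j=\max\Bigl\{\xi^{(q)}_{\varphi_q(j)+2N}-\xi^{(p)}_{\varphi_p(j)},\ \xi^{(q)}_{\varphi_q(j)+N}-\xi^{(p)}_{\varphi_p(j)-N}\Bigr\},$$ that the coefficients $a^{(i)}_{k,n}$ are bounded, and that for all $i\in I$ and $j\in J_i$ we have $a^{(i)}_{\varphi_i(j),0}=1$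 and $$\Bigl(\frac{c_{\varphi_i^{-1}(\varphi_i(j)+n)}}{c_j}\Bigr)^{1/2}a^{(i)}_{\varphi_i(j),n}+\Bigl(\frac{c_j}{c_{\varphi_i^{-1}(\varphi_i(j)+n)}}\Bigr)^{1/2}a^{(i)}_{\varphi_i(j)+n,-n}=2\qquad(n=1,\dots,N-1).$$ Then $\{T_{c_jk}g_j\}_{k\in\mathbb Z,\,j\in J}$ and $\{T_{c_jk}h_j\}_{k\in\mathbb Z,\,j\in J}$ are a pair of dual frames for $\check L^2(S)$. -/

import Mathlib

open MeasureTheory Filter Topology Set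
open scoped FourierTransform

/-- The Hilbert space `L²(ℝ)` of complex valued functions with respect to Lebesgue measure. -/
abbrev L2R : Type := Lp (α := ℝ) ℂ 2 (volume : Measure ℝ)

/-- The Fourier transform `f̂` of `f ∈ L²(ℝ)`: the extension to `L²(ℝ)` of
`f̂ γ = ∫ f x * exp (-2 π i γ x) dx`. As a function it is determined up to null sets. -/
noncomputable def hat (f : L2R) : ℝ → ℂ := ((𝓕 f : L2R) : ℝ → ℂ)

/-- The translation operator `(T_a f) x = f (x - a)` on `L²(ℝ)`. -/
noncomputable def translateL2 (a : ℝ) (f : L2R) : L2R :=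
  Lp.compMeasurePreserving (fun x : ℝ => x - a) (measurePreserving_sub_right volume a) f

/-- `{f ∈ L²(ℝ) : supp f̂ ⊆ S}`, i.e. those `f` whose Fourier transform vanishes almost everywhere
outside `S`. -/
noncomputable def bandL2 (S : Set ℝ) : Submodule ℂ L2R where
  carrier := {f | ∀ᵐ γ : ℝ, γ ∉ S → hat f γ = 0}
  zero_mem' := by
    have h0 : (𝓕 (0 : L2R) : L2R) = 0 := (Lp.fourierTransformₗᵢ ℝ ℂ).map_zero
    filter_upwards [Lp.coeFn_zero ℂ 2 (volume : Measure ℝ)] with γ hγ _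
    unfold hat
    rw [h0, hγ]
    rfl
  add_mem' := by
    intro f g hf hg
    have h0 : (𝓕 (f + g) : L2R) = 𝓕 f + 𝓕 g := (Lp.fourierTransformₗᵢ ℝ ℂ).map_add f g
    filter_upwards [hf, hg, Lp.coeFn_add (𝓕 f : L2R) (𝓕 g)] with γ h1 h2 h3 h4
    have h5 := h1 h4
    have h6 := h2 h4
    unfold hat at h5 h6 ⊢
    rw [h0, h3, Pi.add_apply, h5, h6, add_zero]
  smul_mem' := by
    intro r f hf
    have h0 : (𝓕 (r • f) : L2R) = r • 𝓕 f := (Lp.fourierTransformₗᵢ ℝ ℂ).map_smul r f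
    filter_upwards [hf, Lp.coeFn_smul r (𝓕 f : L2R)] with γ h1 h3 h4
    have h5 := h1 h4
    unfold hat at h5 ⊢
    rw [h0, h3, Pi.smul_apply, h5, smul_zero]

/-- `f` is a frame for the subspace `V` of a Hilbert space: all `f i` lie in `V`, and
`A ‖v‖² ≤ ∑ |⟨v, f i⟩|² ≤ B ‖v‖²` on `V` for some `0 < A ≤ B < ∞`. -/
def IsFrameFor {H ι : Type*} [NormedAddCommGroup H] [InnerProductSpace ℂ H]
    (V : Submodule ℂ H) (f : ι → H) : Prop :=
  (∀ i, f i ∈ V) ∧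
  ∃ A B : ℝ, 0 < A ∧ A ≤ B ∧ ∀ v ∈ V,
    Summable (fun i => ‖inner ℂ (f i) v‖ ^ 2) ∧
    A * ‖v‖ ^ 2 ≤ ∑' i, ‖inner ℂ (f i) v‖ ^ 2 ∧
    ∑' i, ‖inner ℂ (f i) v‖ ^ 2 ≤ B * ‖v‖ ^ 2

/-- `f` and `h` are a pair of dual frames for `V`: both are frames for `V`, and
`v = ∑ ⟨v, f i⟩ h i = ∑ ⟨v, h i⟩ f i` for all `v ∈ V`, with unconditional convergence.
(Mathlib's `inner ℂ x y` is conjugate linear in `x`.) -/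
def AreDualFrames {H ι : Type*} [NormedAddCommGroup H] [InnerProductSpace ℂ H]
    (V : Submodule ℂ H) (f h : ι → H) : Prop :=
  IsFrameFor V f ∧ IsFrameFor V h ∧
  ∀ v ∈ V, HasSum (fun i => inner ℂ (f i) v • h i) v ∧ HasSum (fun i => inner ℂ (h i) v • f i) v

/-- The generalized shift invariant system `{T_{c_j k} g_j}`, indexed by `(j, k) ∈ J × ℤ`. -/
noncomputable def gsi {J : Type*} (c : J → ℝ) (g : J → L2R) : J × ℤ → L2R :=
  fun p => translateL2 (c p.1 * p.2) (g p.1)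

/-- The real interval `(a, b]`, with `a = -∞` and `b = ∞` allowed; `b = ∞` gives `(a, ∞)`. -/
def band (a b : EReal) : Set ℝ := {γ | a < (γ : EReal) ∧ (γ : EReal) ≤ b}

/-- `ĝ ≠ 0` on `T`, as a class of functions: `ĝ` does not vanish almost everywhere on `T`. -/
def ActiveOn (g : L2R) (T : Set ℝ) : Prop := ¬ ∀ᵐ γ : ℝ, γ ∈ T → hat g γ = 0

/-- Frequency bands with knots, translation parameters, generators with prescribed frequency
support, and the bijections that place the generators. -/
structure GSISetup (J : Type*) where
  /-- index set of the bands -/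
  I : Set ℤ
  /-- left end points of the bands `S_i = (α_i, β_i]` -/
  α : I → EReal
  /-- right end points of the bands `S_i = (α_i, β_i]` -/
  β : I → EReal
  ordered : ∀ i i' : I, i < i' → β i ≤ α i'
  /-- the knots; being contained in the bands, they also make the bands non-empty -/
  ξ : I → ℤ → ℝ
  knot_mem : ∀ i k, ξ i k ∈ band (α i) (β i)
  knot_le : ∀ i k, ξ i k ≤ ξ i (k + 1)
  knot_atBot : ∀ i, Tendsto (fun k => (ξ i k : EReal)) atBot (𝓝 (α i))
  knot_atTop : ∀ i, Tendsto (fun k => (ξ i k : EReal)) atTop (𝓝 (β i))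
  /-- translation parameters -/
  c : J → ℝ
  c_pos : ∀ j, 0 < c j
  /-- generators -/
  g : J → L2R
  hat_g_real : ∀ j, ∀ᵐ γ : ℝ, (hat (g j) γ).im = 0
  /-- `ĝ_j` has compact support, contained in a finite union of bands -/
  hat_g_compact : ∀ j, ∃ (F : Finset I) (K : Set ℝ), IsCompact K ∧
    K ⊆ (⋃ i ∈ F, band (α i) (β i)) ∧ ∀ᵐ γ : ℝ, γ ∉ K → hat (g j) γ = 0
  /-- the functions `c_j ^ (-1/2) ĝ_j` are uniformly bounded -/
  hat_g_bounded : ∃ C : ℝ, ∀ j, ∀ᵐ γ : ℝ, ‖(((Real.sqrt (c j))⁻¹ : ℝ) : ℂ) * hat (g j) γ‖ ≤ C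
  /-- the index sets `J_i` -/
  Js : I → Set J
  active_mem : ∀ i j, ActiveOn (g j) (band (α i) (β i)) → j ∈ Js i
  /-- the bijections `φ_i : J_i → ℤ` -/
  φ : ∀ i : I, Js i ≃ ℤ
  N : ℕ
  N_pos : 0 < N
  /-- `supp ĝ_j` is contained in the union of `[ξ_{φ_i(j)}, ξ_{φ_i(j)+N}]` over all `i` with
  `ĝ_j ≠ 0` on `S_i` -/
  hat_g_supp : ∀ j, ∀ᵐ γ : ℝ,
    γ ∉ (⋃ (i : I) (hi : ActiveOn (g j) (band (α i) (β i))),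
      Icc (ξ i (φ i ⟨j, active_mem i j hi⟩)) (ξ i (φ i ⟨j, active_mem i j hi⟩ + N))) →
    hat (g j) γ = 0

namespace GSISetup

variable {J : Type*} (D : GSISetup J)

/-- The band `S_i`. -/
def Sband (i : D.I) : Set ℝ := band (D.α i) (D.β i)

/-- The union `S` of the bands. -/
def S : Set ℝ := ⋃ i : D.I, D.Sband i

/-- The set `I_j` of those bands on which `ĝ_j ≠ 0`. -/
def Iact (j : J) : Set D.I := {i | ActiveOn (D.g j) (D.Sband i)}

theorem mem_Js {i : D.I} {j : J} (hi : i ∈ D.Iact j) : j ∈ D.Js i := D.active_mem i j hi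

/-- The index `φ_i⁻¹(φ_i(j) + n) ∈ J_i` for `j ∈ J_i`. -/
def shift (i : D.I) (j : D.Js i) (n : ℤ) : J := ((D.φ i).symm (D.φ i j + n) : D.Js i)

/-- `h` is the family of dual generators with coefficients `a`: each `h_j` has frequency support in
`S`, on `S_i` with `i ∈ I_j` its Fourier transform is
`∑_{|n| ≤ N - 1} a^{(i)}_{φ_i(j), n} ĝ_{φ_i⁻¹(φ_i(j) + n)}`, and on all other `S_i` it is zero. -/
def IsDualGenerators (a : D.I → ℤ → ℤ → ℂ) (h : J → L2R) : Prop :=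
  ∀ j, h j ∈ bandL2 D.S ∧
    (∀ (i : D.I) (hi : i ∈ D.Iact j), ∀ᵐ γ : ℝ, γ ∈ D.Sband i →
      hat (h j) γ = ∑ n ∈ Finset.Icc (-(D.N : ℤ) + 1) ((D.N : ℤ) - 1),
        a i (D.φ i ⟨j, D.mem_Js hi⟩) n * hat (D.g (D.shift i ⟨j, D.mem_Js hi⟩ n)) γ) ∧
    (∀ i : D.I, i ∉ D.Iact j → ∀ᵐ γ : ℝ, γ ∈ D.Sband i → hat (h j) γ = 0)

/-- The number `M_j`, where `p = min I_j` and `q = max I_j`. -/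
noncomputable def M (j : J) (p q : D.I) (hp : IsLeast (D.Iact j) p)
    (hq : IsGreatest (D.Iact j) q) : ℝ :=
  max
    (D.ξ q (D.φ q ⟨j, D.mem_Js hq.1⟩ + 2 * D.N) - D.ξ p (D.φ p ⟨j, D.mem_Js hp.1⟩))
    (D.ξ q (D.φ q ⟨j, D.mem_Js hq.1⟩ + D.N) - D.ξ p (D.φ p ⟨j, D.mem_Js hp.1⟩ - D.N))

end GSISetup

open scoped ComplexConjugate

/-! On the Fourier side the inner products of `v` with `T_{c_j k} g_j`, `k ∈ ℤ`, are scaled Fourier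
coefficients of `conj ĝ_j · v̂`. The bound `c_j ≤ 1 / M_j` puts `supp ĝ_j` in an interval `[A, B]`
of length at most `1 / c_j` and `supp ĥ_j` in `[B - 1 / c_j, A + 1 / c_j]`. Translates of the latter
by nonzero multiples of `1 / c_j` meet `[A, B]` only in a null set, so Parseval leaves only the
diagonal term (`hasSum_conj_mul_charIntegral_of_subset`), and the mixed frame operator is
multiplication by `∑ c_j⁻¹ conj ĝ_j ĥ_j` (`hasSum_integral_gsi`).

Between consecutive knots `ξ_m`, `ξ_{m+1}` of a band only the `G_k = c^{-1/2} ĝ` with `m - N < k ≤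
m` can be nonzero. They are real with sum 1, and the multiplier is a quadratic form in them whose
coefficients at transposed positions add up to 2. Hence it equals `(∑ G_k)² = 1`
(`sum_mul_shift_eq_one`).

The same finite overlap bounds `∑ c_j⁻¹ |ĝ_j|²` and `∑ c_j⁻¹ |ĥ_j|²`, which makes both systems
Bessel (`isBessel_gsi`). Two Bessel families that reproduce each other weakly are dual frames; the
lower bounds come from the duality (`IsBessel.areDualFrames`). -/

/-! ### Translation and the Fourier transform on `L²`. -/

theorem continuous_translateL2 (a : ℝ) : Continuous (translateL2 a) :=
  (Lp.compMeasurePreservingₗᵢ ℂ _ (measurePreserving_sub_right volume a)).continuous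

theorem translateL2_coe (a : ℝ) (f : L2R) : translateL2 a f =ᵐ[volume] fun x => f (x - a) :=
  Lp.coeFn_compMeasurePreserving f _

theorem translateL2_toLp (a : ℝ) (f : SchwartzMap ℝ ℂ) :
    translateL2 a (f.toLp 2) = (f.compSubConstCLM ℂ a).toLp 2 := by
  apply Lp.ext
  have h1 := f.coeFn_toLp 2 (volume : Measure ℝ)
  have h2 := (measurePreserving_sub_right volume a).quasiMeasurePreserving.ae h1
  filter_upwards [translateL2_coe a (f.toLp 2), h2,
    (f.compSubConstCLM ℂ a).coeFn_toLp 2 (volume : Measure ℝ)] with x h3 h4 h5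
  rw [h3, h5, h4]
  rfl

theorem fourier_compSubConst (a : ℝ) (f : SchwartzMap ℝ ℂ) (γ : ℝ) :
    (𝓕 (f.compSubConstCLM ℂ a)) γ = Complex.exp (-(2 * Real.pi * a * γ : ℝ) * Complex.I) * (𝓕 f) γ := by
  rw [SchwartzMap.fourier_coe, SchwartzMap.fourier_coe, Real.fourier_eq', Real.fourier_eq']
  rw [← integral_add_right_eq_self _ a, ← integral_const_mul]
  refine integral_congr_ae (ae_of_all _ fun x => ?_)
  simp only [SchwartzMap.compSubConstCLM_apply, smul_eq_mul, add_sub_cancel_right, ← mul_assoc,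
    ← Complex.exp_add]
  congr 2
  simp
  ring

/-- Multiplication by a bounded measurable function, as a bounded operator on `L²(ℝ)`. -/
theorem exists_mul_clm (m : ℝ → ℂ) (hm : MemLp m ⊤ (volume : Measure ℝ)) :
    ∃ A : L2R →L[ℂ] L2R, ∀ f : L2R, A f =ᵐ[volume] fun x => m x * f x := by
  refine ⟨(ContinuousLinearMap.mul ℂ ℂ).holderL volume ⊤ 2 2 hm.toLp, fun f => ?_⟩
  have := (ContinuousLinearMap.mul ℂ ℂ).coeFn_holder (r := 2) (hm.toLp) f
  filter_upwards [this, hm.coeFn_toLp] with x h1 h2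
  rw [← h2]
  exact h1

theorem hat_translateL2 (a : ℝ) (f : L2R) : hat (translateL2 a f) =ᵐ[volume]
    fun γ => Complex.exp (-(2 * Real.pi * a * γ : ℝ) * Complex.I) * hat f γ := by
  have hm : MemLp (fun γ : ℝ => Complex.exp (-(2 * Real.pi * a * γ : ℝ) * Complex.I)) ⊤
      (volume : Measure ℝ) := by
    refine memLp_top_of_bound (Continuous.aestronglyMeasurable (by fun_prop)) 1
      (ae_of_all _ fun γ => ?_)
    rw [← Complex.ofReal_neg, Complex.norm_exp_ofReal_mul_I]
  obtain ⟨A, hA⟩ := exists_mul_clm _ hm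
  have key : 𝓕 (translateL2 a f) = A (𝓕 f) := by
    -- Both sides are continuous in `f`, so Schwartz functions suffice.
    refine DenseRange.induction_on (p := fun f : L2R => 𝓕 (translateL2 a f) = A (𝓕 f))
      (SchwartzMap.denseRange_toLpCLM (p := 2) ENNReal.ofNat_ne_top) f ?_ ?_
    · exact isClosed_eq ((Lp.fourierTransformₗᵢ ℝ ℂ).continuous.comp (continuous_translateL2 a))
        (A.continuous.comp (Lp.fourierTransformₗᵢ ℝ ℂ).continuous)
    · intro f
      change 𝓕 (translateL2 a (f.toLp 2)) = A (𝓕 (f.toLp 2))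
      rw [translateL2_toLp, SchwartzMap.toLp_fourier_eq, SchwartzMap.toLp_fourier_eq]
      apply Lp.ext
      filter_upwards [hA ((𝓕 f).toLp 2), (𝓕 f).coeFn_toLp 2 (volume : Measure ℝ),
        (𝓕 (f.compSubConstCLM ℂ a)).coeFn_toLp 2 (volume : Measure ℝ)] with γ h1 h2 h3
      rw [h1, h2, h3, fourier_compSubConst]
  unfold hat
  rw [key]
  exact hA _

theorem memLp_hat (f : L2R) : MemLp (hat f) 2 (volume : Measure ℝ) := Lp.memLp _

theorem inner_eq_integral_hat (f v : L2R) :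
    inner ℂ f v = ∫ γ, conj (hat f γ) * hat v γ := by
  rw [← Lp.inner_fourier_eq, L2.inner_def]
  simp only [RCLike.inner_apply']
  rfl

theorem norm_sq_eq_integral_hat (v : L2R) : ‖v‖ ^ 2 = ∫ γ, ‖hat v γ‖ ^ 2 := by
  have h : ((‖v‖ ^ 2 : ℝ) : ℂ) = inner ℂ v v := by
    rw [inner_self_eq_norm_sq_to_K]; push_cast; rfl
  rw [inner_eq_integral_hat] at h
  rw [← Complex.ofReal_inj, h, ← integral_complex_ofReal]
  congr 1 with γ
  rw [mul_comm, Complex.mul_conj, Complex.normSq_eq_norm_sq]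

/-- The integral of `F` against the character of frequency `a`. -/
noncomputable def charIntegral (a : ℝ) (F : ℝ → ℂ) : ℂ :=
  ∫ γ, Complex.exp ((2 * Real.pi * a * γ : ℝ) * Complex.I) * F γ

theorem inner_translateL2 (a : ℝ) (f v : L2R) :
    inner ℂ (translateL2 a f) v = charIntegral a (fun γ => conj (hat f γ) * hat v γ) := by
  rw [inner_eq_integral_hat, charIntegral]
  refine integral_congr_ae ?_
  filter_upwards [hat_translateL2 a f] with γ h
  rw [h, map_mul, ← Complex.exp_conj, map_mul, map_neg, Complex.conj_ofReal, Complex.conj_I,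
    neg_mul_neg, mul_assoc]

/-! ### Parseval identities for functions of short support. -/

theorem hasSum_conj_mul_fourierCoeffOn {a b : ℝ} {F H : ℝ → ℂ} (hab : a < b)
    (hF : MemLp F 2 (volume.restrict (Ioc a b))) (hH : MemLp H 2 (volume.restrict (Ioc a b))) :
    HasSum (fun i => conj (fourierCoeffOn hab H i) * fourierCoeffOn hab F i)
      ((b - a)⁻¹ • ∫ x in a..b, conj (H x) * F x) := by
  have := Fact.mk (by linarith : 0 < b - a)
  -- Lifting to the circle of length `b - a` needs the interval in the form `(a, a + (b - a)]`.
  rw [← add_sub_cancel a b] at hF hH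
  have hf := hF.memLp_liftIoc.haarAddCircle
  have hh := hH.memLp_liftIoc.haarAddCircle
  convert! fourierBasis.hasSum_inner_mul_inner hh.toLp hf.toLp using 2 with i
  · rw [← inner_conj_symm, ← HilbertBasis.repr_apply_apply, ← HilbertBasis.repr_apply_apply,
      fourierBasis_repr, fourierBasis_repr, fourierCoeff_congr_ae hh.coeFn_toLp,
      fourierCoeff_congr_ae hf.coeFn_toLp, fourierCoeff_liftIoc_eq, fourierCoeff_liftIoc_eq]
    simp
  · rw [L2.inner_def]
    nth_rw 2 [← add_sub_cancel a b]
    rw [← AddCircle.integral_liftIoc_eq_intervalIntegral, ← AddCircle.integral_haarAddCircle]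
    apply integral_congr_ae
    filter_upwards [hh.coeFn_toLp, hf.coeFn_toLp] with x h1 h2
    rw [h1, h2, RCLike.inner_apply']
    rfl

theorem charIntegral_eq_fourierCoeffOn {a b c : ℝ} {F : ℝ → ℂ} (hab : a < b) (hc : b - a = c⁻¹)
    (hF : ∀ᵐ x : ℝ, x ∉ Ioc a b → F x = 0) (k : ℤ) :
    charIntegral (c * k) F = (c⁻¹ : ℝ) • fourierCoeffOn hab F (-k) := by
  have hc0 : c⁻¹ ≠ 0 := by rw [← hc]; linarith
  rw [fourierCoeffOn_eq_integral, hc, smul_smul, mul_one_div_cancel hc0, one_smul,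
    intervalIntegral.integral_of_le hab.le, charIntegral,
    ← setIntegral_eq_integral_of_ae_compl_eq_zero]
  · refine setIntegral_congr_fun measurableSet_Ioc fun x _ => ?_
    simp only [neg_neg, smul_eq_mul]
    rw [fourier_coe_apply]
    congr 2
    push_cast
    rw [div_inv_eq_mul]
    ring
  · filter_upwards [hF] with x hx hx'
    rw [hx hx', mul_zero]

/-- Parseval's identity for functions supported in an interval of length `1 / c`. -/
theorem hasSum_conj_mul_charIntegral {a c : ℝ} {F H : ℝ → ℂ} (hc : 0 < c)
    (hF : MemLp F 2) (hH : MemLp H 2)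
    (hFs : ∀ᵐ x : ℝ, x ∉ Icc a (a + c⁻¹) → F x = 0)
    (hHs : ∀ᵐ x : ℝ, x ∉ Icc a (a + c⁻¹) → H x = 0) :
    HasSum (fun k : ℤ => conj (charIntegral (c * k) H) * charIntegral (c * k) F)
      ((c⁻¹ : ℝ) * ∫ x, conj (H x) * F x) := by
  have hab : a < a + c⁻¹ := by have := inv_pos.2 hc; linarith
  have key : ∀ G : ℝ → ℂ, (∀ᵐ x : ℝ, x ∉ Icc a (a + c⁻¹) → G x = 0) →
      ∀ᵐ x : ℝ, x ∉ Ioc a (a + c⁻¹) → G x = 0 := by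
    intro G hG
    filter_upwards [hG, Measure.ae_ne volume a] with x h1 h2 h3
    exact h1 fun h => h3 ⟨lt_of_le_of_ne h.1 h2.symm, h.2⟩
  have h1 := hasSum_conj_mul_fourierCoeffOn hab (hF.restrict _) (hH.restrict _)
  -- `charIntegral` carries the character with a plus sign, Fourier coefficients with a minus sign,
  -- hence `k ↦ -k`. Each factor contributes one `c⁻¹`.
  have h2 := ((Equiv.neg ℤ).hasSum_iff.2 h1).mul_left ((c⁻¹ : ℂ) * (c⁻¹ : ℂ))
  convert! h2 using 1
  · funext k
    rw [charIntegral_eq_fourierCoeffOn hab (by ring) (key H hHs),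
      charIntegral_eq_fourierCoeffOn hab (by ring) (key F hFs)]
    simp
    ring
  · rw [intervalIntegral.integral_of_le hab.le, setIntegral_eq_integral_of_ae_compl_eq_zero]
    · simp
      field_simp
    · filter_upwards [key F hFs] with x hx hx'
      rw [hx hx', mul_zero]

theorem hasSum_norm_sq_charIntegral {a c : ℝ} {F : ℝ → ℂ} (hc : 0 < c) (hF : MemLp F 2)
    (hFs : ∀ᵐ x : ℝ, x ∉ Icc a (a + c⁻¹) → F x = 0) :
    HasSum (fun k : ℤ => ‖charIntegral (c * k) F‖ ^ 2) (c⁻¹ * ∫ x, ‖F x‖ ^ 2) := by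
  have h := hasSum_conj_mul_charIntegral hc hF hF hFs hFs
  simp only [RCLike.conj_mul] at h
  rw [← Complex.hasSum_ofReal]
  push_cast
  convert! h using 2
  · simp
  · rw [← integral_complex_ofReal]
    simp

theorem charIntegral_add {a : ℝ} {F G : ℝ → ℂ} {A B : ℝ} (hF : MemLp F 2) (hG : MemLp G 2)
    (hFs : ∀ᵐ x : ℝ, x ∉ Icc A B → F x = 0) (hGs : ∀ᵐ x : ℝ, x ∉ Icc A B → G x = 0) :
    charIntegral a (F + G) = charIntegral a F + charIntegral a G := by
  have key : ∀ G : ℝ → ℂ, MemLp G 2 → (∀ᵐ x : ℝ, x ∉ Icc A B → G x = 0) →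
      Integrable (fun γ : ℝ => Complex.exp ((2 * Real.pi * a * γ : ℝ) * Complex.I) * G γ) := by
    intro G hG hGs
    have h1 : IntegrableOn G (Icc A B) := (hG.restrict _).integrable (by norm_num)
    have h2 : Integrable G := h1.integrable_of_ae_notMem_eq_zero hGs
    refine h2.bdd_mul (c := 1) (Continuous.aestronglyMeasurable (by fun_prop)) (ae_of_all _ fun γ => ?_)
    rw [Complex.norm_exp_ofReal_mul_I]
  unfold charIntegral
  rw [← integral_add (key F hF hFs) (key G hG hGs)]
  simp only [Pi.add_apply, mul_add]

/-- If `F` is supported in `[A, B]` and `H` is supported in `[B - 1 / c, A + 1 / c]`, then `H` is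
the sum of two functions that are each supported in an interval of length `1 / c` containing
`[A, B]`. -/
theorem exists_split {A B c : ℝ} {H : ℝ → ℂ} (hle : A ≤ B) (hc : 0 < c) (hH : MemLp H 2)
    (hHs : ∀ᵐ x : ℝ, x ∉ Icc (B - c⁻¹) (A + c⁻¹) → H x = 0) :
    ∃ H₁ H₂ : ℝ → ℂ, MemLp H₁ 2 ∧ MemLp H₂ 2 ∧
      (∀ᵐ x : ℝ, x ∉ Icc (B - c⁻¹) (B - c⁻¹ + c⁻¹) → H₁ x = 0) ∧
      (∀ᵐ x : ℝ, x ∉ Icc A (A + c⁻¹) → H₂ x = 0) ∧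
      (∀ x, A ≤ x → H₁ x = 0 ∧ H₂ x = H x) ∧
      (∀ x, ‖H₁ x‖ ^ 2 + ‖H₂ x‖ ^ 2 = ‖H x‖ ^ 2) ∧
      ∀ a, charIntegral a H = charIntegral a H₁ + charIntegral a H₂ := by
  have h0 : 0 < c⁻¹ := inv_pos.2 hc
  have hs : ∀ S : Set ℝ, ∀ᵐ x : ℝ, x ∉ Icc (B - c⁻¹) (A + c⁻¹) → S.indicator H x = 0 := by
    intro S
    filter_upwards [hHs] with x hx hx'
    simp [indicator, hx hx']
  refine ⟨(Iio A).indicator H, (Ici A).indicator H, hH.indicator measurableSet_Iio,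
    hH.indicator measurableSet_Ici, ?_, ?_, ?_, ?_, ?_⟩
  · filter_upwards [hHs] with x hx hx'
    rw [indicator_apply_eq_zero]
    exact fun h => hx fun h' => hx' ⟨h'.1, by rw [mem_Iio] at h; linarith⟩
  · filter_upwards [hHs] with x hx hx'
    rw [indicator_apply_eq_zero]
    exact fun h => hx fun h' => hx' ⟨h, h'.2⟩
  · intro x hx
    exact ⟨indicator_of_notMem (by simpa using hx) _, indicator_of_mem hx _⟩
  · intro x
    by_cases h : x < A
    · simp [h]
    · simp [h, not_lt.1 h]
  · intro a
    rw [← charIntegral_add (hH.indicator measurableSet_Iio) (hH.indicator measurableSet_Ici)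
      (hs _) (hs _)]
    congr 1
    rw [← compl_Iio, indicator_self_add_compl]

/-- A Parseval identity for two functions whose supports do not meet modulo `1 / c`, except where
they actually meet. -/
theorem hasSum_conj_mul_charIntegral_of_subset {A B c : ℝ} {F H : ℝ → ℂ} (hle : A ≤ B)
    (hAB : B - A ≤ c⁻¹) (hc : 0 < c) (hF : MemLp F 2) (hH : MemLp H 2)
    (hFs : ∀ᵐ x : ℝ, x ∉ Icc A B → F x = 0)
    (hHs : ∀ᵐ x : ℝ, x ∉ Icc (B - c⁻¹) (A + c⁻¹) → H x = 0) :
    HasSum (fun k : ℤ => conj (charIntegral (c * k) H) * charIntegral (c * k) F)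
      ((c⁻¹ : ℝ) * ∫ x, conj (H x) * F x) := by
  obtain ⟨H₁, H₂, m₁, m₂, s₁, s₂, e, -, ha⟩ := exists_split hle hc hH hHs
  have i₁ := hasSum_conj_mul_charIntegral hc hF m₁ (by
    filter_upwards [hFs] with x hx hx'
    exact hx fun h => hx' ⟨by linarith [h.1], by linarith [h.2]⟩) s₁
  have i₂ := hasSum_conj_mul_charIntegral hc hF m₂ (by
    filter_upwards [hFs] with x hx hx'
    exact hx fun h => hx' ⟨h.1, by linarith [h.2]⟩) s₂
  have j₁ : ∫ x, conj (H₁ x) * F x = 0 := by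
    rw [← integral_zero ℝ ℂ]
    refine integral_congr_ae ?_
    filter_upwards [hFs] with x hx
    by_cases h : A ≤ x
    · simp [(e x h).1]
    · simp [hx fun h' => h h'.1]
  have j₂ : ∫ x, conj (H₂ x) * F x = ∫ x, conj (H x) * F x := by
    refine integral_congr_ae ?_
    filter_upwards [hFs] with x hx
    by_cases h : A ≤ x
    · simp [(e x h).2]
    · simp [hx fun h' => h h'.1]
  convert! i₁.add i₂ using 1
  · funext k
    rw [ha, map_add, add_mul]
  · rw [j₁, j₂, mul_zero, zero_add]

/-- A Bessel inequality for functions supported in an interval of length at most `2 / c`. -/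
theorem summable_norm_sq_charIntegral {A B c : ℝ} {H : ℝ → ℂ} (hle : A ≤ B)
    (hc : 0 < c) (hH : MemLp H 2)
    (hHs : ∀ᵐ x : ℝ, x ∉ Icc (B - c⁻¹) (A + c⁻¹) → H x = 0) :
    Summable (fun k : ℤ => ‖charIntegral (c * k) H‖ ^ 2) ∧
      ∑' k : ℤ, ‖charIntegral (c * k) H‖ ^ 2 ≤ 2 * (c⁻¹ * ∫ x, ‖H x‖ ^ 2) := by
  obtain ⟨H₁, H₂, m₁, m₂, s₁, s₂, -, e, ha⟩ := exists_split hle hc hH hHs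
  have i₁ := hasSum_norm_sq_charIntegral hc m₁ s₁
  have i₂ := hasSum_norm_sq_charIntegral hc m₂ s₂
  have h := (i₁.add i₂).mul_left 2
  have hk : ∀ k : ℤ, ‖charIntegral (c * k) H‖ ^ 2 ≤
      2 * (‖charIntegral (c * k) H₁‖ ^ 2 + ‖charIntegral (c * k) H₂‖ ^ 2) := by
    intro k
    rw [ha]
    have h1 := norm_add_le (charIntegral (c * k) H₁) (charIntegral (c * k) H₂)
    have h2 := norm_nonneg (charIntegral (c * k) H₁ + charIntegral (c * k) H₂)
    nlinarith [sq_nonneg (‖charIntegral (c * k) H₁‖ - ‖charIntegral (c * k) H₂‖)]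
  have hs : Summable (fun k : ℤ => ‖charIntegral (c * k) H‖ ^ 2) :=
    h.summable.of_nonneg_of_le (fun _ => sq_nonneg _) hk
  refine ⟨hs, (hasSum_le hk hs.hasSum h).trans_eq ?_⟩
  rw [← mul_add, ← integral_add (m₁.integrable_norm_pow two_ne_zero)
    (m₂.integrable_norm_pow two_ne_zero)]
  simp only [e]

/-! ### Bessel families and dual frames in a Hilbert space. -/

section Hilbert

variable {H ι : Type*} [NormedAddCommGroup H] [InnerProductSpace ℂ H]

/-- The Bessel property with bound `B`. -/
def IsBessel (B : ℝ) (f : ι → H) : Prop :=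
  ∀ v, Summable (fun i => ‖inner ℂ (f i) v‖ ^ 2) ∧ ∑' i, ‖inner ℂ (f i) v‖ ^ 2 ≤ B * ‖v‖ ^ 2

/-- Pair the sum `x` with itself and apply the arithmetic-geometric mean inequality with weight `B`;
the Bessel bound turns the second half into `‖x‖² / 2`, which is absorbed. -/
theorem IsBessel.norm_sum_sq_le {B : ℝ} {f : ι → H} (hf : IsBessel B f) (hB : 0 < B) (c : ι → ℂ)
    (s : Finset ι) : ‖∑ i ∈ s, c i • f i‖ ^ 2 ≤ B * ∑ i ∈ s, ‖c i‖ ^ 2 := by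
  set x := ∑ i ∈ s, c i • f i with hx
  have h1 : ‖x‖ ^ 2 ≤ ∑ i ∈ s, ‖c i‖ * ‖inner ℂ (f i) x‖ := by
    have h : ((‖x‖ ^ 2 : ℝ) : ℂ) = ∑ i ∈ s, c i * inner ℂ x (f i) := by
      push_cast
      rw [← RCLike.ofReal_eq_complex_ofReal, ← inner_self_eq_norm_sq_to_K]
      nth_rw 2 [hx]
      rw [inner_sum]
      simp [inner_smul_right]
    calc ‖x‖ ^ 2 = ‖((‖x‖ ^ 2 : ℝ) : ℂ)‖ := by simp
      _ ≤ ∑ i ∈ s, ‖c i * inner ℂ x (f i)‖ := by rw [h]; exact norm_sum_le _ _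
      _ = _ := by simp only [norm_mul, norm_inner_symm x]
  have h2 : ∑ i ∈ s, ‖inner ℂ (f i) x‖ ^ 2 ≤ B * ‖x‖ ^ 2 :=
    ((hf x).1.sum_le_tsum s fun _ _ => sq_nonneg _).trans (hf x).2
  have h3 : ∑ i ∈ s, ‖c i‖ * ‖inner ℂ (f i) x‖ ≤
      ∑ i ∈ s, (B / 2 * ‖c i‖ ^ 2 + B⁻¹ / 2 * ‖inner ℂ (f i) x‖ ^ 2) := by
    refine Finset.sum_le_sum fun i _ => ?_
    have := sq_nonneg (B * ‖c i‖ - ‖inner ℂ (f i) x‖)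
    have h4 : 0 ≤ B⁻¹ * (B * ‖c i‖ - ‖inner ℂ (f i) x‖) ^ 2 := by positivity
    have h5 : B⁻¹ * (B * ‖c i‖ - ‖inner ℂ (f i) x‖) ^ 2 = B * ‖c i‖ ^ 2 -
      2 * (‖c i‖ * ‖inner ℂ (f i) x‖) + B⁻¹ * ‖inner ℂ (f i) x‖ ^ 2 := by field_simp; ring
    linarith
  rw [Finset.sum_add_distrib, ← Finset.mul_sum, ← Finset.mul_sum] at h3
  have h4 : B⁻¹ / 2 * ∑ i ∈ s, ‖inner ℂ (f i) x‖ ^ 2 ≤ B⁻¹ / 2 * (B * ‖x‖ ^ 2) := by gcongr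
  have h5 : B⁻¹ / 2 * (B * ‖x‖ ^ 2) = ‖x‖ ^ 2 / 2 := by field_simp
  linarith

theorem IsBessel.summable_smul [CompleteSpace H] {B : ℝ} {f : ι → H} (hf : IsBessel B f)
    (hB : 0 < B) {c : ι → ℂ} (hc : Summable fun i => ‖c i‖ ^ 2) :
    Summable fun i => c i • f i := by
  rw [summable_iff_vanishing_norm]
  intro ε hε
  obtain ⟨s, hs⟩ := summable_iff_vanishing_norm.1 hc (ε ^ 2 / B) (by positivity)
  refine ⟨s, fun t ht => ?_⟩
  have h1 := hf.norm_sum_sq_le hB c t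
  have h2 := (le_abs_self _).trans_lt (hs t ht)
  rw [lt_div_iff₀ hB] at h2
  exact lt_of_pow_lt_pow_left₀ 2 hε.le (by linarith)

/-- If the coefficients with respect to `f` are square summable, the family `h` is Bessel, and the
two families reproduce `v` weakly, then the expansion of `v` converges in norm, unconditionally. -/
theorem IsBessel.hasSum_smul [CompleteSpace H] {B : ℝ} {f h : ι → H} {v : H}
    (hv : Summable (fun i => ‖inner ℂ (f i) v‖ ^ 2)) (hh : IsBessel B h) (hB : 0 < B)
    (hw : ∀ w, HasSum (fun i => inner ℂ (f i) v * inner ℂ w (h i)) (inner ℂ w v)) :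
    HasSum (fun i => inner ℂ (f i) v • h i) v := by
  have hs := hh.summable_smul hB hv
  convert! hs.hasSum
  refine ext_inner_left ℂ fun w => (hw w).unique ?_
  have := hs.hasSum.mapL (innerSL ℂ w)
  simpa [inner_smul_right] using this

/-- The weighted mean inequality splits the expansion of `⟨v, v⟩`; the part with `h` is at most
`‖v‖² / 2`. -/
theorem IsBessel.le_tsum {B : ℝ} {f h : ι → H} {v : H}
    (hv : Summable (fun i => ‖inner ℂ (f i) v‖ ^ 2)) (hh : IsBessel B h) (hB : 0 < B)
    (hw : HasSum (fun i => inner ℂ (f i) v * inner ℂ v (h i)) (inner ℂ v v)) :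
    B⁻¹ * ‖v‖ ^ 2 ≤ ∑' i, ‖inner ℂ (f i) v‖ ^ 2 := by
  have h1 : ∀ i, ‖inner ℂ (f i) v * inner ℂ v (h i)‖ ≤
      B / 2 * ‖inner ℂ (f i) v‖ ^ 2 + B⁻¹ / 2 * ‖inner ℂ (h i) v‖ ^ 2 := by
    intro i
    rw [norm_mul, norm_inner_symm v]
    set p := ‖inner ℂ (f i) v‖
    set q := ‖inner ℂ (h i) v‖
    have h4 : 0 ≤ B⁻¹ * (B * p - q) ^ 2 := by positivity
    have h5 : B⁻¹ * (B * p - q) ^ 2 = B * p ^ 2 - 2 * (p * q) + B⁻¹ * q ^ 2 := by field_simp; ring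
    linarith
  have h2 := (hv.hasSum.mul_left (B / 2)).add ((hh v).1.hasSum.mul_left (B⁻¹ / 2))
  have h3 := tsum_of_norm_bounded h2 h1
  rw [hw.tsum_eq, inner_self_eq_norm_sq_to_K] at h3
  have h3' : ‖v‖ ^ 2 ≤ B / 2 * ∑' i, ‖inner ℂ (f i) v‖ ^ 2 +
      B⁻¹ / 2 * ∑' i, ‖inner ℂ (h i) v‖ ^ 2 := by simpa using h3
  have h4 : B⁻¹ / 2 * ∑' i, ‖inner ℂ (h i) v‖ ^ 2 ≤ B⁻¹ / 2 * (B * ‖v‖ ^ 2) := by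
    gcongr
    exact (hh v).2
  have h5 : B⁻¹ / 2 * (B * ‖v‖ ^ 2) = ‖v‖ ^ 2 / 2 := by field_simp
  have h6 : B⁻¹ * ‖v‖ ^ 2 ≤ B⁻¹ * (B * ∑' i, ‖inner ℂ (f i) v‖ ^ 2) := by
    gcongr
    linarith
  rwa [inv_mul_cancel_left₀ hB.ne'] at h6

theorem IsBessel.isFrameFor {V : Submodule ℂ H} {B : ℝ} {f h : ι → H} (hfV : ∀ i, f i ∈ V)
    (hf : IsBessel B f) (hh : IsBessel B h) (hB : 0 < B)
    (hw : ∀ v ∈ V, HasSum (fun i => inner ℂ (f i) v * inner ℂ v (h i)) (inner ℂ v v)) :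
    IsFrameFor V f := by
  -- The lower bound obtained is `B⁻¹`; the minimum secures that it does not exceed the upper bound.
  refine ⟨hfV, min B⁻¹ B, B, by positivity, min_le_right _ _, fun v hv => ⟨(hf v).1, ?_, (hf v).2⟩⟩
  refine le_trans ?_ (IsBessel.le_tsum (hf v).1 hh hB (hw v hv))
  gcongr
  exact min_le_left _ _

/-- Norm limits are identified by testing against all of `H`, so only one of the two vectors may be
required to lie in `V`. Allowing either one lets conjugation exchange the roles of `f` and `h`. -/
theorem IsBessel.areDualFrames [CompleteSpace H] {V : Submodule ℂ H} {B : ℝ} {f h : ι → H}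
    (hfV : ∀ i, f i ∈ V) (hhV : ∀ i, h i ∈ V)
    (hf : IsBessel B f) (hh : IsBessel B h) (hB : 0 < B)
    (hw : ∀ v w, v ∈ V ∨ w ∈ V →
      HasSum (fun i => inner ℂ (f i) v * inner ℂ w (h i)) (inner ℂ w v)) :
    AreDualFrames V f h := by
  have hw' : ∀ v w, v ∈ V → HasSum (fun i => inner ℂ (h i) v * inner ℂ w (f i)) (inner ℂ w v) := by
    intro v w hv
    have := (hw w v (Or.inr hv)).map (starRingEnd ℂ) Complex.continuous_conj
    rw [inner_conj_symm] at this
    convert! this using 2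
    simp [mul_comm]
  refine ⟨hf.isFrameFor hfV hh hB fun v hv => hw v v (Or.inl hv),
    hh.isFrameFor hhV hf hB fun v hv => hw' v v hv, fun v hv => ⟨?_, ?_⟩⟩
  · exact hh.hasSum_smul (hf v).1 hB fun w => hw v w (Or.inl hv)
  · exact hf.hasSum_smul (hh v).1 hB fun w => hw' v w hv

end Hilbert

/-! ### Generalized shift-invariant systems. -/

theorem translateL2_mem_bandL2 {S : Set ℝ} {f : L2R} (hf : f ∈ bandL2 S) (a : ℝ) :
    translateL2 a f ∈ bandL2 S := by
  change ∀ᵐ γ : ℝ, γ ∉ S → hat (translateL2 a f) γ = 0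
  have h : ∀ᵐ γ : ℝ, γ ∉ S → hat f γ = 0 := hf
  filter_upwards [h, hat_translateL2 a f] with γ h1 h2 h3
  rw [h2, h1 h3, mul_zero]

theorem aestronglyMeasurable_hat (f : L2R) : AEStronglyMeasurable (hat f) (volume : Measure ℝ) :=
  (memLp_hat f).aestronglyMeasurable

section

variable {J : Type*} {c : J → ℝ} {g h : J → L2R} {C : ℝ}

theorem norm_hat_le_of_sum_le (hc : ∀ j, 0 < c j)
    (hC : ∀ᵐ γ : ℝ, ∀ s : Finset J, ∑ j ∈ s, (c j)⁻¹ * ‖hat (g j) γ‖ ^ 2 ≤ C) (j : J) :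
    ∀ᵐ γ : ℝ, ‖hat (g j) γ‖ ≤ Real.sqrt (c j * C) := by
  filter_upwards [hC] with γ h
  have := h {j}
  rw [Finset.sum_singleton, inv_mul_le_iff₀ (hc j)] at this
  exact Real.le_sqrt_of_sq_le this

theorem memLp_conj_hat_mul_hat (hc : ∀ j, 0 < c j)
    (hC : ∀ᵐ γ : ℝ, ∀ s : Finset J, ∑ j ∈ s, (c j)⁻¹ * ‖hat (g j) γ‖ ^ 2 ≤ C) (j : J) (v : L2R) :
    MemLp (fun γ => conj (hat (g j) γ) * hat v γ) 2 := by
  refine (memLp_hat v).of_le_mul (c := Real.sqrt (c j * C))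
    ((aestronglyMeasurable_hat (g j)).star.mul (aestronglyMeasurable_hat v)) ?_
  filter_upwards [norm_hat_le_of_sum_le hc hC j] with γ h
  rw [norm_mul, RCLike.norm_conj]
  gcongr

theorem sum_integral_norm_le [Countable J] (hc : ∀ j, 0 < c j)
    (hC : ∀ᵐ γ : ℝ, ∀ s : Finset J, ∑ j ∈ s, (c j)⁻¹ * ‖hat (g j) γ‖ ^ 2 ≤ C) (v : L2R)
    (s : Finset J) :
    ∑ j ∈ s, (c j)⁻¹ * ∫ γ, ‖conj (hat (g j) γ) * hat v γ‖ ^ 2 ≤ C * ‖v‖ ^ 2 := by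
  have hi : ∀ j ∈ s, Integrable fun γ => (c j)⁻¹ * ‖conj (hat (g j) γ) * hat v γ‖ ^ 2 :=
    fun j _ => ((memLp_conj_hat_mul_hat hc hC j v).integrable_norm_pow two_ne_zero).const_mul _
  simp only [← integral_const_mul]
  rw [← integral_finsetSum _ hi, norm_sq_eq_integral_hat, ← integral_const_mul]
  refine integral_mono_ae (integrable_finsetSum _ hi)
    (((memLp_hat v).integrable_norm_pow two_ne_zero).const_mul _) ?_
  filter_upwards [hC] with γ h
  calc ∑ j ∈ s, (c j)⁻¹ * ‖conj (hat (g j) γ) * hat v γ‖ ^ 2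
      = (∑ j ∈ s, (c j)⁻¹ * ‖hat (g j) γ‖ ^ 2) * ‖hat v γ‖ ^ 2 := by
        rw [Finset.sum_mul]
        refine Finset.sum_congr rfl fun j _ => ?_
        rw [norm_mul, RCLike.norm_conj]
        ring
    _ ≤ C * ‖hat v γ‖ ^ 2 := by
        gcongr
        exact h s

/-- For fixed `j` the support has length at most `2 / c_j`, so summing over `k` costs a factor 2;
the pointwise bound `C` then controls the sum over `j`. -/
theorem isBessel_gsi [Countable J] {A B : J → ℝ} (hc : ∀ j, 0 < c j) (hle : ∀ j, A j ≤ B j)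
    (hs : ∀ j, ∀ᵐ γ : ℝ, γ ∉ Icc (B j - (c j)⁻¹) (A j + (c j)⁻¹) → hat (g j) γ = 0)
    (hC : ∀ᵐ γ : ℝ, ∀ s : Finset J, ∑ j ∈ s, (c j)⁻¹ * ‖hat (g j) γ‖ ^ 2 ≤ C) :
    IsBessel (2 * C) (gsi c g) := by
  intro v
  have h1 := fun j => summable_norm_sq_charIntegral (hle j) (hc j)
    (memLp_conj_hat_mul_hat hc hC j v) (by
      filter_upwards [hs j] with γ h h'
      simp [h h'])
  have e : ∀ p : J × ℤ, inner ℂ (gsi c g p) v =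
      charIntegral (c p.1 * p.2) (fun γ => conj (hat (g p.1) γ) * hat v γ) :=
    fun p => inner_translateL2 _ _ _
  simp only [e]
  have h2 : ∀ s : Finset J, ∑ j ∈ s,
      ∑' k : ℤ, ‖charIntegral (c j * k) (fun γ => conj (hat (g j) γ) * hat v γ)‖ ^ 2 ≤
      2 * C * ‖v‖ ^ 2 := by
    intro s
    refine (Finset.sum_le_sum fun j _ => (h1 j).2).trans ?_
    rw [← Finset.mul_sum, mul_assoc]
    gcongr
    exact sum_integral_norm_le hc hC v s
  have h3 : Summable fun j =>
      ∑' k : ℤ, ‖charIntegral (c j * k) (fun γ => conj (hat (g j) γ) * hat v γ)‖ ^ 2 :=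
    summable_of_sum_le (fun j => tsum_nonneg fun _ => sq_nonneg _) h2
  have h4 : Summable fun p : J × ℤ =>
      ‖charIntegral (c p.1 * p.2) (fun γ => conj (hat (g p.1) γ) * hat v γ)‖ ^ 2 :=
    (summable_prod_of_nonneg fun p => sq_nonneg _).2 ⟨fun j => (h1 j).1, h3⟩
  refine ⟨h4, ?_⟩
  rw [h4.tsum_prod' fun j => (h1 j).1]
  exact h3.tsum_le_of_sum_le h2

/-- The frame operator of a pair of generalized shift-invariant systems acts, on the Fourier side,
as multiplication by `∑ j, (c j)⁻¹ * conj (hat (g j)) * hat (h j)`. -/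
theorem hasSum_integral_gsi [Countable J] (hc : ∀ j, 0 < c j) {S : Set ℝ}
    (hgC : ∀ᵐ γ : ℝ, ∀ s : Finset J, ∑ j ∈ s, (c j)⁻¹ * ‖hat (g j) γ‖ ^ 2 ≤ C)
    (hhC : ∀ᵐ γ : ℝ, ∀ s : Finset J, ∑ j ∈ s, (c j)⁻¹ * ‖hat (h j) γ‖ ^ 2 ≤ C)
    (hgh : ∀ᵐ γ : ℝ, γ ∈ S →
      HasSum (fun j => (((c j)⁻¹ : ℝ) : ℂ) * (conj (hat (g j) γ) * hat (h j) γ)) 1)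
    {v w : L2R} (hvw : v ∈ bandL2 S ∨ w ∈ bandL2 S) :
    HasSum (fun j => (((c j)⁻¹ : ℝ) : ℂ) *
        ∫ γ, conj (conj (hat (h j) γ) * hat w γ) * (conj (hat (g j) γ) * hat v γ))
      (inner ℂ w v) := by
  simp only [← integral_const_mul]
  have hi : ∀ j, Integrable fun γ => (((c j)⁻¹ : ℝ) : ℂ) *
      (conj (conj (hat (h j) γ) * hat w γ) * (conj (hat (g j) γ) * hat v γ)) := fun j =>
    ((memLp_conj_hat_mul_hat hc hhC j w).star.integrable_mul
      (memLp_conj_hat_mul_hat hc hgC j v)).const_mul _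
  -- Absolute summability, from `|xy| ≤ |x|² + |y|²`, justifies interchanging sum and integral.
  have hsum : Summable fun j => ∫ γ, ‖(((c j)⁻¹ : ℝ) : ℂ) *
      (conj (conj (hat (h j) γ) * hat w γ) * (conj (hat (g j) γ) * hat v γ))‖ := by
    refine summable_of_sum_le (c := C * ‖w‖ ^ 2 + C * ‖v‖ ^ 2)
      (fun j => integral_nonneg fun γ => norm_nonneg _) fun s => ?_
    refine le_trans ?_ (add_le_add (sum_integral_norm_le hc hhC w s)
      (sum_integral_norm_le hc hgC v s))
    rw [← Finset.sum_add_distrib]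
    refine Finset.sum_le_sum fun j _ => ?_
    have m₁ := (memLp_conj_hat_mul_hat hc hhC j w).integrable_norm_pow two_ne_zero
    have m₂ := (memLp_conj_hat_mul_hat hc hgC j v).integrable_norm_pow two_ne_zero
    rw [← mul_add, ← integral_add m₁ m₂, ← integral_const_mul]
    refine integral_mono (hi j).norm ((m₁.add m₂).const_mul _) fun γ => ?_
    have := hc j
    change ‖(((c j)⁻¹ : ℝ) : ℂ) * (conj (conj (hat (h j) γ) * hat w γ) *
      (conj (hat (g j) γ) * hat v γ))‖ ≤ (c j)⁻¹ * (‖conj (hat (h j) γ) * hat w γ‖ ^ 2 +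
        ‖conj (hat (g j) γ) * hat v γ‖ ^ 2)
    rw [norm_mul, norm_mul, RCLike.norm_conj, Complex.norm_of_nonneg (by positivity)]
    gcongr
    nlinarith [sq_nonneg (‖conj (hat (h j) γ) * hat w γ‖ - ‖conj (hat (g j) γ) * hat v γ‖),
      sq_nonneg (‖conj (hat (h j) γ) * hat w γ‖), sq_nonneg (‖conj (hat (g j) γ) * hat v γ‖)]
  convert! hasSum_integral_of_summable_integral_norm hi hsum using 1
  rw [inner_eq_integral_hat]
  refine integral_congr_ae ?_
  have hz : ∀ᵐ γ : ℝ, γ ∉ S → conj (hat w γ) * hat v γ = 0 := by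
    rcases hvw with hv | hw
    · have hv : ∀ᵐ γ : ℝ, γ ∉ S → hat v γ = 0 := hv
      filter_upwards [hv] with γ h1 h2
      rw [h1 h2, mul_zero]
    · have hw : ∀ᵐ γ : ℝ, γ ∉ S → hat w γ = 0 := hw
      filter_upwards [hw] with γ h1 h2
      rw [h1 h2, map_zero, zero_mul]
  filter_upwards [hz, hgh] with γ h1 h2
  have e : ∀ j, (((c j)⁻¹ : ℝ) : ℂ) *
      (conj (conj (hat (h j) γ) * hat w γ) * (conj (hat (g j) γ) * hat v γ)) =
      (((c j)⁻¹ : ℝ) : ℂ) * (conj (hat (g j) γ) * hat (h j) γ) * (conj (hat w γ) * hat v γ) := by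
    intro j
    rw [map_mul, Complex.conj_conj]
    ring
  simp only [e]
  by_cases hγ : γ ∈ S
  · rw [((h2 hγ).mul_right _).tsum_eq, one_mul]
  · simp [h1 hγ]

/-- A pair of generalized shift-invariant systems, with generators whose frequency supports are
so short that only the diagonal terms of the frame operator survive. -/
theorem areDualFrames_gsi [Countable J] {A B : J → ℝ} {S : Set ℝ} (hc : ∀ j, 0 < c j)
    (hC0 : 0 < C) (hle : ∀ j, A j ≤ B j) (hlen : ∀ j, B j - A j ≤ (c j)⁻¹)
    (hgs : ∀ j, ∀ᵐ γ : ℝ, γ ∉ Icc (A j) (B j) → hat (g j) γ = 0)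
    (hhs : ∀ j, ∀ᵐ γ : ℝ, γ ∉ Icc (B j - (c j)⁻¹) (A j + (c j)⁻¹) → hat (h j) γ = 0)
    (hgS : ∀ j, g j ∈ bandL2 S) (hhS : ∀ j, h j ∈ bandL2 S)
    (hgC : ∀ᵐ γ : ℝ, ∀ s : Finset J, ∑ j ∈ s, (c j)⁻¹ * ‖hat (g j) γ‖ ^ 2 ≤ C)
    (hhC : ∀ᵐ γ : ℝ, ∀ s : Finset J, ∑ j ∈ s, (c j)⁻¹ * ‖hat (h j) γ‖ ^ 2 ≤ C)
    (hgh : ∀ᵐ γ : ℝ, γ ∈ S →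
      HasSum (fun j => (((c j)⁻¹ : ℝ) : ℂ) * (conj (hat (g j) γ) * hat (h j) γ)) 1) :
    AreDualFrames (bandL2 S) (gsi c g) (gsi c h) := by
  have bg : IsBessel (2 * C) (gsi c g) := by
    refine isBessel_gsi hc hle (fun j => ?_) hgC
    filter_upwards [hgs j] with γ h1 h2
    exact h1 fun h3 => h2 ⟨by linarith [h3.1, hlen j], by linarith [h3.2, hlen j]⟩
  have bh : IsBessel (2 * C) (gsi c h) := isBessel_gsi hc hle hhs hhC
  refine bg.areDualFrames (fun p => translateL2_mem_bandL2 (hgS _) _)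
    (fun p => translateL2_mem_bandL2 (hhS _) _) bh (by positivity) fun v w hvw => ?_
  -- The two Bessel bounds give summability over `J × ℤ`, so the value may be computed by summing
  -- over `k` first.
  have hs : Summable fun p => inner ℂ (gsi c g p) v * inner ℂ w (gsi c h p) := by
    refine ((bg v).1.add (bh w).1).of_norm_bounded fun p => ?_
    rw [norm_mul, norm_inner_symm w]
    nlinarith [sq_nonneg (‖inner ℂ (gsi c g p) v‖ - ‖inner ℂ (gsi c h p) w‖),
      sq_nonneg (‖inner ℂ (gsi c g p) v‖), sq_nonneg (‖inner ℂ (gsi c h p) w‖)]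
  have hf : ∀ j, HasSum (fun k : ℤ => inner ℂ (gsi c g (j, k)) v * inner ℂ w (gsi c h (j, k)))
      ((((c j)⁻¹ : ℝ) : ℂ) *
        ∫ γ, conj (conj (hat (h j) γ) * hat w γ) * (conj (hat (g j) γ) * hat v γ)) := by
    intro j
    convert! hasSum_conj_mul_charIntegral_of_subset (hle j) (hlen j) (hc j)
      (memLp_conj_hat_mul_hat hc hgC j v) (memLp_conj_hat_mul_hat hc hhC j w) ?_ ?_ using 2 with k
    · rw [← inner_conj_symm w, mul_comm]
      exact congrArg₂ (fun x y => conj x * y) (inner_translateL2 _ _ _) (inner_translateL2 _ _ _)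
    · filter_upwards [hgs j] with γ h1 h2
      simp [h1 h2]
    · filter_upwards [hhs j] with γ h1 h2
      simp [h1 h2]
  have ht := hs.hasSum.prod_fiberwise hf
  rw [(hasSum_integral_gsi hc hgC hhC hgh hvw).unique ht]
  exact hs.hasSum

end

/-! ### The quadratic form and elementary bounds. -/

/-- If `x k n + x (k + n) (-n) = 2`, then the quadratic form with these coefficients is the square
of the sum. -/
theorem sum_mul_shift_eq_one {N : ℕ} {m : ℤ} {G : ℤ → ℂ} {x : ℤ → ℤ → ℂ}
    (hG : ∀ k, k ∉ Finset.Icc (m - N + 1) m → G k = 0)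
    (hsum : ∑ k ∈ Finset.Icc (m - N + 1) m, G k = 1)
    (hx0 : ∀ k, x k 0 = 1)
    (hx : ∀ k, ∀ n ∈ Finset.Icc (1 : ℤ) (N - 1), x k n + x (k + n) (-n) = 2) :
    ∑ k ∈ Finset.Icc (m - N + 1) m,
      G k * ∑ n ∈ Finset.Icc (-(N : ℤ) + 1) (N - 1), x k n * G (k + n) = 1 := by
  set s := Finset.Icc (m - N + 1) m with hs
  -- Substitute `l = k + n`. The range of `n` reaches all of `s`, as indices in `s` differ by at
  -- most `N - 1`; the surplus `l` have `G l = 0`.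
  have h1 : ∀ k ∈ s, ∑ n ∈ Finset.Icc (-(N : ℤ) + 1) (N - 1), x k n * G (k + n) =
      ∑ l ∈ s, x k (l - k) * G l := by
    intro k hk
    rw [hs, Finset.mem_Icc] at hk
    have h2 : ∑ n ∈ Finset.Icc (-(N : ℤ) + 1) (N - 1), x k n * G (k + n) =
        ∑ l ∈ (Finset.Icc (-(N : ℤ) + 1) (N - 1)).map (addLeftEmbedding k), x k (l - k) * G l := by
      rw [Finset.sum_map]
      simp only [addLeftEmbedding_apply, add_sub_cancel_left]
    rw [h2, Finset.map_add_left_Icc]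
    symm
    apply Finset.sum_subset
    · exact Finset.Icc_subset_Icc (by omega) (by omega)
    · intro l _ hl
      rw [hG l hl, mul_zero]
  have hy : ∀ k ∈ s, ∀ l ∈ s, x k (l - k) + x l (k - l) = 2 := by
    intro k hk l hl
    rw [hs, Finset.mem_Icc] at hk hl
    rcases lt_trichotomy k l with h | rfl | h
    · have := hx k (l - k) (by rw [Finset.mem_Icc]; omega)
      simpa using this
    · rw [sub_self, hx0]; norm_num
    · have := hx l (k - l) (by rw [Finset.mem_Icc]; omega)
      rw [add_comm]
      simpa using this
  rw [Finset.sum_congr rfl fun k hk => by rw [h1 k hk, Finset.mul_sum]]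
  have h3 : ∑ k ∈ s, ∑ l ∈ s, G k * (x k (l - k) * G l) =
      ∑ k ∈ s, ∑ l ∈ s, G k * (x l (k - l) * G l) := by
    rw [Finset.sum_comm]
    refine Finset.sum_congr rfl fun k _ => Finset.sum_congr rfl fun l _ => by ring
  have h4 : ∑ k ∈ s, ∑ l ∈ s, G k * (x k (l - k) * G l) +
      ∑ k ∈ s, ∑ l ∈ s, G k * (x l (k - l) * G l) = 2 * ((∑ k ∈ s, G k) * ∑ l ∈ s, G l) := by
    rw [Finset.sum_mul_sum, Finset.mul_sum, ← Finset.sum_add_distrib]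
    refine Finset.sum_congr rfl fun k hk => ?_
    rw [Finset.mul_sum, ← Finset.sum_add_distrib]
    refine Finset.sum_congr rfl fun l hl => ?_
    rw [← hy k hk l hl]
    ring
  rw [← h3, hsum] at h4
  linear_combination h4 / 2

/-- One of the two ratios is at most 1, so its term is bounded by `C`; the other term is 2 minus it.
No bound on `p / q` is needed. -/
theorem norm_sqrt_div_mul_le {p q C : ℝ} {z w : ℂ} (hp : 0 < p) (hq : 0 < q) (hz : ‖z‖ ≤ C)
    (hw : ‖w‖ ≤ C) (h : (Real.sqrt (p / q) : ℂ) * z + (Real.sqrt (q / p) : ℂ) * w = 2) :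
    ‖(Real.sqrt (p / q) : ℂ) * z‖ ≤ 2 + C := by
  have key : ∀ {r : ℝ} {z : ℂ}, r ≤ 1 → ‖z‖ ≤ C → ‖(Real.sqrt r : ℂ) * z‖ ≤ C := by
    intro r z hr hz
    rw [norm_mul, Complex.norm_of_nonneg (Real.sqrt_nonneg _)]
    exact (mul_le_of_le_one_left (norm_nonneg _) (Real.sqrt_le_one.2 hr)).trans hz
  rcases le_total p q with hpq | hpq
  · have := key (r := p / q) ((div_le_one hq).2 hpq) hz
    linarith
  · rw [← eq_sub_iff_add_eq] at h
    rw [h]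
    refine (norm_sub_le _ _).trans ?_
    have := key (r := q / p) ((div_le_one hp).2 hpq) hw
    rw [Complex.norm_ofNat]
    linarith

theorem sum_le_card_mul_of_ne_zero {J : Type*} [DecidableEq J] {f : J → ℝ} {T : Finset J} {K : ℝ}
    (hf : ∀ j, 0 ≤ f j) (hK : ∀ j, f j ≤ K) (hT : ∀ j, f j ≠ 0 → j ∈ T) (s : Finset J) :
    ∑ j ∈ s, f j ≤ T.card * K := by
  calc ∑ j ∈ s, f j = ∑ j ∈ s.filter (fun j => f j ≠ 0), f j := (Finset.sum_filter_ne_zero s).symm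
    _ ≤ ∑ j ∈ T, f j := Finset.sum_le_sum_of_subset_of_nonneg
        (fun j hj => hT j (Finset.mem_filter.1 hj).2) fun j _ _ => hf j
    _ ≤ T.card * K := by
        rw [← nsmul_eq_mul]
        exact Finset.sum_le_card_nsmul _ _ _ fun j _ => hK j

/-! ### Knots, bands and frequency supports. -/

namespace GSISetup

variable {J : Type*} (D : GSISetup J)

theorem knot_mono (i : D.I) : Monotone (D.ξ i) := monotone_int_of_le_succ (D.knot_le i)

theorem eq_of_mem_Sband {i i' : D.I} {γ : ℝ} (h : γ ∈ D.Sband i) (h' : γ ∈ D.Sband i') :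
    i = i' := by
  rcases lt_trichotomy i i' with hlt | rfl | hlt
  · exact absurd (h'.1.trans_le (h.2.trans (D.ordered _ _ hlt))) (lt_irrefl _)
  · rfl
  · exact absurd (h.1.trans_le (h'.2.trans (D.ordered _ _ hlt))) (lt_irrefl _)

theorem lt_of_mem_Sband {i i' : D.I} (hlt : i < i') {γ γ' : ℝ} (h : γ ∈ D.Sband i)
    (h' : γ' ∈ D.Sband i') : γ < γ' :=
  EReal.coe_lt_coe_iff.1 (h.2.trans_lt ((D.ordered _ _ hlt).trans_lt h'.1))

theorem mem_Sband_of_mem_Icc {i : D.I} {k l : ℤ} {γ : ℝ} (h : γ ∈ Icc (D.ξ i k) (D.ξ i l)) :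
    γ ∈ D.Sband i :=
  ⟨(D.knot_mem i k).1.trans_le (EReal.coe_le_coe_iff.2 h.1),
    (EReal.coe_le_coe_iff.2 h.2).trans (D.knot_mem i l).2⟩

/-- `I_j` is finite: `ĝ_j` lives on finitely many bands, and the bands are disjoint. -/
theorem exists_isLeast_isGreatest {j : J} (hj : (D.Iact j).Nonempty) :
    ∃ p q, IsLeast (D.Iact j) p ∧ IsGreatest (D.Iact j) q := by
  obtain ⟨F, K, -, hKF, hK⟩ := D.hat_g_compact j
  have hfin : (D.Iact j).Finite := by
    refine F.finite_toSet.subset fun i hi => ?_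
    by_contra hF
    refine hi ?_
    filter_upwards [hK] with γ h1 h2
    refine h1 fun h3 => ?_
    obtain ⟨i', hi', h4⟩ := mem_iUnion₂.1 (hKF h3)
    rw [D.eq_of_mem_Sband h2 h4] at hF
    exact hF hi'
  have hne : hfin.toFinset.Nonempty := by simpa using hj
  refine ⟨hfin.toFinset.min' hne, hfin.toFinset.max' hne, ?_, ?_⟩
  · simpa using hfin.toFinset.isLeast_min' hne
  · simpa using hfin.toFinset.isGreatest_max' hne

/-- The index of the generator that belongs to the knot `ξ i k`. -/
def gen (i : D.I) (k : ℤ) : J := ((D.φ i).symm k : D.Js i)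

theorem gen_φ (i : D.I) (j : D.Js i) : D.gen i (D.φ i j) = j := by
  rw [gen, Equiv.symm_apply_apply]

theorem φ_gen {i : D.I} {k : ℤ} (hk : D.gen i k ∈ D.Js i) : D.φ i ⟨D.gen i k, hk⟩ = k :=
  (D.φ i).apply_symm_apply k

theorem hasSum_gen_iff {E : Type*} [AddCommMonoid E] [TopologicalSpace E] {i : D.I} {f : J → E}
    {x : E} (hf : ∀ j, j ∉ D.Js i → f j = 0) :
    HasSum (fun k => f (D.gen i k)) x ↔ HasSum f x :=
  (Subtype.val_injective.comp (D.φ i).symm.injective).hasSum_iff fun j hj => hf j fun hj' =>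
    hj ⟨D.φ i ⟨j, hj'⟩, D.gen_φ i ⟨j, hj'⟩⟩

/-- On the band `S_i` only the generators with `i ∈ I_j` matter, and they live between their
knots. -/
theorem ae_mem_Icc_of_hat_ne_zero [Countable J] : ∀ᵐ γ : ℝ, ∀ j, hat (D.g j) γ ≠ 0 →
    ∃ (i : D.I) (hi : i ∈ D.Iact j), γ ∈ D.Sband i ∧
      γ ∈ Icc (D.ξ i (D.φ i ⟨j, D.mem_Js hi⟩)) (D.ξ i (D.φ i ⟨j, D.mem_Js hi⟩ + D.N)) := by
  rw [ae_all_iff]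
  intro j
  filter_upwards [D.hat_g_supp j] with γ h h0
  by_contra hcon
  refine h0 (h fun hmem => hcon ?_)
  obtain ⟨i, hi, h1⟩ := mem_iUnion₂.1 hmem
  exact ⟨i, hi, D.mem_Sband_of_mem_Icc h1, h1⟩

theorem ae_ne_knots : ∀ᵐ γ : ℝ, ∀ i, (∀ k, γ ≠ D.ξ i k) ∧ (γ : EReal) ≠ D.β i := by
  rw [ae_all_iff]
  intro i
  have h1 : ∀ᵐ γ : ℝ, ∀ k, γ ≠ D.ξ i k := ae_all_iff.2 fun k => Measure.ae_ne volume _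
  -- For infinite `β i` the default value 0 of `toReal` merely discards one harmless point.
  filter_upwards [h1, Measure.ae_ne volume (D.β i).toReal] with γ h2 h3
  refine ⟨h2, fun h4 => h3 ?_⟩
  rw [← h4, EReal.toReal_coe]

/-- Every point of `S_i`, except for the knots and the right end point, lies between two
consecutive knots. -/
theorem exists_knot_lt_lt {i : D.I} {γ : ℝ} (hγ : γ ∈ D.Sband i) (h1 : ∀ k, γ ≠ D.ξ i k)
    (h2 : (γ : EReal) ≠ D.β i) :
    ∃ m, ∀ k l, γ ∈ Icc (D.ξ i k) (D.ξ i l) → k ≤ m ∧ m < l := by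
  obtain ⟨k₀, hk₀⟩ := ((D.knot_atBot i).eventually (gt_mem_nhds hγ.1)).exists
  obtain ⟨k₁, hk₁⟩ := ((D.knot_atTop i).eventually
    (lt_mem_nhds (lt_of_le_of_ne hγ.2 h2))).exists
  rw [EReal.coe_lt_coe_iff] at hk₀ hk₁
  -- Taking the greatest index with `ξ_m ≤ γ` also handles repeated knots.
  obtain ⟨m, hm, hmax⟩ := Int.exists_greatest_of_bdd (P := fun k => D.ξ i k ≤ γ)
    ⟨k₁, fun z hz => le_of_not_gt fun hlt => (hz.trans_lt hk₁).not_ge (D.knot_mono i hlt.le)⟩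
    ⟨k₀, hk₀.le⟩
  refine ⟨m, fun k l hkl => ⟨hmax k hkl.1, lt_of_not_ge fun hlm => ?_⟩⟩
  exact h1 l (le_antisymm hkl.2 ((D.knot_mono i hlm).trans hm))

/-- In different bands every knot of the left one lies below every knot of the right one, whatever
the offsets. -/
theorem knot_add_le {j : J} {p i : D.I} (hp : p ∈ D.Iact j) (hi : i ∈ D.Iact j) (hpi : p ≤ i)
    {m n : ℤ} (hmn : m ≤ n) :
    D.ξ p (D.φ p ⟨j, D.mem_Js hp⟩ + m) ≤ D.ξ i (D.φ i ⟨j, D.mem_Js hi⟩ + n) := by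
  rcases hpi.eq_or_lt with rfl | hlt
  · exact D.knot_mono p (by omega)
  · exact (D.lt_of_mem_Sband hlt (D.knot_mem _ _) (D.knot_mem _ _)).le

/-- Pointwise form of the support condition on the generators, in terms of the knots of `S_i`. -/
theorem mem_Icc_of_hat_gen_ne_zero {γ : ℝ}
    (hγ : ∀ j, hat (D.g j) γ ≠ 0 → ∃ (i : D.I) (hi : i ∈ D.Iact j), γ ∈ D.Sband i ∧
      γ ∈ Icc (D.ξ i (D.φ i ⟨j, D.mem_Js hi⟩)) (D.ξ i (D.φ i ⟨j, D.mem_Js hi⟩ + D.N)))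
    {i : D.I} (hi : γ ∈ D.Sband i) {k : ℤ} (hk : hat (D.g (D.gen i k)) γ ≠ 0) :
    i ∈ D.Iact (D.gen i k) ∧ γ ∈ Icc (D.ξ i k) (D.ξ i (k + D.N)) := by
  obtain ⟨i', hi', h1, h2⟩ := hγ _ hk
  obtain rfl := D.eq_of_mem_Sband hi h1
  rw [D.φ_gen] at h2
  exact ⟨hi', h2⟩

/-- Pointwise form of the definition of the dual generators. -/
theorem IsDualGenerators.ae [Countable J] {D : GSISetup J} {a : D.I → ℤ → ℤ → ℂ} {h : J → L2R}
    (hdual : D.IsDualGenerators a h) : ∀ᵐ γ : ℝ, ∀ j, (γ ∉ D.S → hat (h j) γ = 0) ∧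
      ∀ i, γ ∈ D.Sband i →
        (∀ hi : i ∈ D.Iact j, hat (h j) γ = ∑ n ∈ Finset.Icc (-(D.N : ℤ) + 1) ((D.N : ℤ) - 1),
          a i (D.φ i ⟨j, D.mem_Js hi⟩) n *
            hat (D.g (D.gen i (D.φ i ⟨j, D.mem_Js hi⟩ + n))) γ) ∧
        (i ∉ D.Iact j → hat (h j) γ = 0) := by
  rw [ae_all_iff]
  intro j
  obtain ⟨h1, h2, h3⟩ := hdual j
  have h1 : ∀ᵐ γ : ℝ, γ ∉ D.S → hat (h j) γ = 0 := h1
  have h4 : ∀ᵐ γ : ℝ, ∀ i, γ ∈ D.Sband i →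
        (∀ hi : i ∈ D.Iact j, hat (h j) γ = ∑ n ∈ Finset.Icc (-(D.N : ℤ) + 1) ((D.N : ℤ) - 1),
          a i (D.φ i ⟨j, D.mem_Js hi⟩) n *
            hat (D.g (D.gen i (D.φ i ⟨j, D.mem_Js hi⟩ + n))) γ) ∧
        (i ∉ D.Iact j → hat (h j) γ = 0) := by
    rw [ae_all_iff]
    intro i
    by_cases hi : i ∈ D.Iact j
    · filter_upwards [h2 i hi] with γ h5 h6
      exact ⟨fun _ => h5 h6, fun h7 => absurd hi h7⟩
    · filter_upwards [h3 i hi] with γ h5 h6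
      exact ⟨fun h7 => absurd h7 hi, fun _ => h5 h6⟩
  filter_upwards [h1, h4] with γ h5 h6
  exact ⟨h5, h6⟩

/-- Take `A = ξ^p_{φ_p(j)}` and `B = ξ^q_{φ_q(j)+N}`. The offsets in `ĥ_j` satisfy `|n| < N`, so its
support reaches at most `N` knots further on either side; the two entries of `M_j` are the distances
to be kept below `1 / c_j`. -/
theorem exists_support_intervals [Countable J] {a : D.I → ℤ → ℤ → ℂ} {h : J → L2R}
    (hdual : D.IsDualGenerators a h)
    (hc : ∀ (j : J) (p q : D.I) (hp : IsLeast (D.Iact j) p) (hq : IsGreatest (D.Iact j) q),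
      D.c j ≤ 1 / D.M j p q hp hq) (j : J) :
    ∃ A B : ℝ, A ≤ B ∧ B - A ≤ (D.c j)⁻¹ ∧
      (∀ᵐ γ : ℝ, γ ∉ Icc A B → hat (D.g j) γ = 0) ∧
      (∀ᵐ γ : ℝ, γ ∉ Icc (B - (D.c j)⁻¹) (A + (D.c j)⁻¹) → hat (h j) γ = 0) := by
  rcases (D.Iact j).eq_empty_or_nonempty with hj | hj
  · refine ⟨0, 0, le_rfl, by simpa using (D.c_pos j).le, ?_, ?_⟩
    · filter_upwards [D.ae_mem_Icc_of_hat_ne_zero] with γ h1 _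
      by_contra h2
      obtain ⟨i, hi, -⟩ := h1 j h2
      simp [hj] at hi
    · filter_upwards [hdual.ae] with γ h1 _
      by_cases hS : γ ∈ D.S
      · obtain ⟨i, hi⟩ := mem_iUnion.1 hS
        exact ((h1 j).2 i hi).2 (by simp [hj])
      · exact (h1 j).1 hS
  obtain ⟨p, q, hp, hq⟩ := D.exists_isLeast_isGreatest hj
  have hM := hc j p q hp hq
  -- Positivity of `M_j` follows from `0 < c_j ≤ 1 / M_j`, since `1 / 0 = 0`.
  have hM0 : 0 < D.M j p q hp hq := one_div_pos.1 ((D.c_pos j).trans_le hM)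
  rw [le_one_div (D.c_pos j) hM0, one_div] at hM
  have hM1 := (le_max_left _ _).trans hM
  have hM2 := (le_max_right _ _).trans hM
  have k1 := fun {m n : ℤ} (h : m ≤ n) => D.knot_add_le hp.1 hq.1 (hp.2 hq.1) h
  have k0 := @k1 0 D.N (by positivity)
  have k2 := D.knot_mono q (show D.φ q ⟨j, D.mem_Js hq.1⟩ + D.N ≤
    D.φ q ⟨j, D.mem_Js hq.1⟩ + 2 * D.N by omega)
  rw [add_zero] at k0
  refine ⟨_, _, k0, by linarith, ?_, ?_⟩
  · filter_upwards [D.ae_mem_Icc_of_hat_ne_zero] with γ h1 h2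
    by_contra h3
    obtain ⟨i, hi, -, h4⟩ := h1 j h3
    have h5 := D.knot_add_le hp.1 hi (hp.2 hi) le_rfl (m := 0)
    have h6 := D.knot_add_le hi hq.1 (hq.2 hi) le_rfl (m := D.N)
    rw [add_zero, add_zero] at h5
    exact h2 ⟨h5.trans h4.1, h4.2.trans h6⟩
  · filter_upwards [D.ae_mem_Icc_of_hat_ne_zero, hdual.ae] with γ h1 h2 h3
    by_contra h4
    by_cases hS : γ ∈ D.S
    swap
    · exact h4 ((h2 j).1 hS)
    obtain ⟨i, hγ⟩ := mem_iUnion.1 hS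
    by_cases hi : i ∈ D.Iact j
    swap
    · exact h4 (((h2 j).2 i hγ).2 hi)
    rw [((h2 j).2 i hγ).1 hi] at h4
    obtain ⟨n, hn, hne⟩ := Finset.exists_ne_zero_of_sum_ne_zero h4
    rw [Finset.mem_Icc] at hn
    have h5 := (D.mem_Icc_of_hat_gen_ne_zero h1 hγ (right_ne_zero_of_mul hne)).2
    have h6 := D.knot_add_le hp.1 hi (hp.2 hi) (show -(D.N : ℤ) ≤ n by omega)
    have h7 := D.knot_add_le hi hq.1 (hq.2 hi) (show n + (D.N : ℤ) ≤ 2 * D.N by omega)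
    rw [← sub_eq_add_neg] at h6
    rw [← add_assoc] at h7
    exact h3 ⟨by linarith [h5.1], by linarith [h5.2]⟩

/-! ### Normalized generators, pointwise bounds and duality. -/

/-- The generators, normalized so that they sum to `1`, at the point `γ`. -/
noncomputable def normGen (i : D.I) (γ : ℝ) (k : ℤ) : ℂ :=
  (((Real.sqrt (D.c (D.gen i k)))⁻¹ : ℝ) : ℂ) * hat (D.g (D.gen i k)) γ

/-- The coefficients of the dual generators relative to `normGen`. -/
noncomputable def normCoeff (a : D.I → ℤ → ℤ → ℂ) (i : D.I) (k n : ℤ) : ℂ :=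
  ((Real.sqrt (D.c (D.gen i (k + n)) / D.c (D.gen i k)) : ℝ) : ℂ) * a i k n

section Coefficients

variable {D} {a : D.I → ℤ → ℤ → ℂ}

theorem normCoeff_zero (ha_zero : ∀ (i : D.I) (j : D.Js i), a i (D.φ i j) 0 = 1) (i : D.I)
    (k : ℤ) : D.normCoeff a i k 0 = 1 := by
  have := ha_zero i ((D.φ i).symm k)
  rw [Equiv.apply_symm_apply] at this
  rw [normCoeff, this, add_zero, div_self (D.c_pos _).ne']
  simp

theorem normCoeff_add (ha_sum : ∀ (i : D.I) (j : D.Js i), ∀ n ∈ Finset.Icc (1 : ℤ) ((D.N : ℤ) - 1),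
      ((Real.sqrt (D.c (D.shift i j n) / D.c j) : ℝ) : ℂ) * a i (D.φ i j) n +
        ((Real.sqrt (D.c j / D.c (D.shift i j n)) : ℝ) : ℂ) * a i (D.φ i j + n) (-n) = 2)
    (i : D.I) (k : ℤ) {n : ℤ} (hn : n ∈ Finset.Icc (1 : ℤ) ((D.N : ℤ) - 1)) :
    D.normCoeff a i k n + D.normCoeff a i (k + n) (-n) = 2 := by
  have := ha_sum i ((D.φ i).symm k) n hn
  rw [shift, Equiv.apply_symm_apply] at this
  rw [normCoeff, normCoeff, add_neg_cancel_right]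
  exact this

theorem norm_normCoeff_le {C : ℝ}
    (hbdd : ∀ (i : D.I) (k : ℤ), ∀ n ∈ Finset.Icc (-(D.N : ℤ) + 1) ((D.N : ℤ) - 1), ‖a i k n‖ ≤ C)
    (ha_zero : ∀ (i : D.I) (j : D.Js i), a i (D.φ i j) 0 = 1)
    (ha_sum : ∀ (i : D.I) (j : D.Js i), ∀ n ∈ Finset.Icc (1 : ℤ) ((D.N : ℤ) - 1),
      ((Real.sqrt (D.c (D.shift i j n) / D.c j) : ℝ) : ℂ) * a i (D.φ i j) n +
        ((Real.sqrt (D.c j / D.c (D.shift i j n)) : ℝ) : ℂ) * a i (D.φ i j + n) (-n) = 2)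
    (i : D.I) (k : ℤ) {n : ℤ} (hn : n ∈ Finset.Icc (-(D.N : ℤ) + 1) ((D.N : ℤ) - 1)) :
    ‖D.normCoeff a i k n‖ ≤ 2 + C := by
  have hC := (norm_nonneg _).trans (hbdd i k n hn)
  have hn' := Finset.mem_Icc.1 hn
  have hneg : -n ∈ Finset.Icc (-(D.N : ℤ) + 1) ((D.N : ℤ) - 1) := by
    rw [Finset.mem_Icc]; omega
  rcases lt_trichotomy n 0 with h | rfl | h
  -- For negative `n` the pairing identity is read from the partner index `k + n`.
  · have := normCoeff_add ha_sum i (k + n) (n := -n) (by rw [Finset.mem_Icc]; omega)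
    rw [add_neg_cancel_right, neg_neg, add_comm] at this
    refine norm_sqrt_div_mul_le (w := a i (k + n) (-n)) (D.c_pos _) (D.c_pos _) (hbdd i k n hn)
      (hbdd _ _ _ hneg) ?_
    simpa only [normCoeff, add_neg_cancel_right] using this
  · rw [normCoeff_zero ha_zero, norm_one]; linarith
  · have := normCoeff_add ha_sum i k (n := n) (by rw [Finset.mem_Icc]; omega)
    refine norm_sqrt_div_mul_le (w := a i (k + n) (-n)) (D.c_pos _) (D.c_pos _) (hbdd i k n hn)
      (hbdd _ _ _ hneg) ?_
    simpa only [normCoeff, add_neg_cancel_right] using this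

theorem normCoeff_mul_normGen (i : D.I) (γ : ℝ) (k n : ℤ) :
    D.normCoeff a i k n * D.normGen i γ (k + n) =
      (((Real.sqrt (D.c (D.gen i k)))⁻¹ : ℝ) : ℂ) *
        (a i k n * hat (D.g (D.gen i (k + n))) γ) := by
  have h1 : ((Real.sqrt (D.c (D.gen i (k + n))) : ℝ) : ℂ) ≠ 0 :=
    Complex.ofReal_ne_zero.2 (Real.sqrt_pos.2 (D.c_pos _)).ne'
  rw [normCoeff, normGen, Real.sqrt_div (D.c_pos _).le]
  push_cast
  field_simp

end Coefficients

theorem inv_mul_norm_sq (j : J) (z : ℂ) :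
    (D.c j)⁻¹ * ‖z‖ ^ 2 = ‖(((Real.sqrt (D.c j))⁻¹ : ℝ) : ℂ) * z‖ ^ 2 := by
  rw [norm_mul, Complex.norm_of_nonneg (inv_nonneg.2 (Real.sqrt_nonneg _)), mul_pow, inv_pow,
    Real.sq_sqrt (D.c_pos j).le]

variable {D} {a : D.I → ℤ → ℤ → ℂ} {h : J → L2R}

theorem normDual_eq_sum {γ : ℝ} {i : D.I} {j : J} (hi : i ∈ D.Iact j)
    (hγ : hat (h j) γ = ∑ n ∈ Finset.Icc (-(D.N : ℤ) + 1) ((D.N : ℤ) - 1),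
      a i (D.φ i ⟨j, D.mem_Js hi⟩) n * hat (D.g (D.gen i (D.φ i ⟨j, D.mem_Js hi⟩ + n))) γ) :
    (((Real.sqrt (D.c j))⁻¹ : ℝ) : ℂ) * hat (h j) γ =
      ∑ n ∈ Finset.Icc (-(D.N : ℤ) + 1) ((D.N : ℤ) - 1),
        D.normCoeff a i (D.φ i ⟨j, D.mem_Js hi⟩) n *
          D.normGen i γ (D.φ i ⟨j, D.mem_Js hi⟩ + n) := by
  rw [hγ, Finset.mul_sum]
  refine Finset.sum_congr rfl fun n _ => ?_
  rw [normCoeff_mul_normGen, gen_φ]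

theorem ae_sum_norm_sq_hat_g_le [Countable J] :
    ∃ C : ℝ, ∀ᵐ γ : ℝ, ∀ s : Finset J, ∑ j ∈ s, (D.c j)⁻¹ * ‖hat (D.g j) γ‖ ^ 2 ≤ C := by
  classical
  obtain ⟨C, hC⟩ := D.hat_g_bounded
  -- At most `N` generators are nonzero at `γ`.
  refine ⟨D.N * C ^ 2, ?_⟩
  filter_upwards [D.ae_mem_Icc_of_hat_ne_zero, D.ae_ne_knots, ae_all_iff.2 hC] with γ h1 h2 h3 s
  by_cases hS : γ ∈ D.S
  · obtain ⟨i, hγ⟩ := mem_iUnion.1 hS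
    obtain ⟨m, hm⟩ := D.exists_knot_lt_lt hγ (h2 i).1 (h2 i).2
    refine (sum_le_card_mul_of_ne_zero
      (T := (Finset.Icc (m - D.N + 1) m).image (D.gen i)) (K := C ^ 2)
      (fun j => by have := D.c_pos j; positivity) (fun j => ?_) (fun j hj => ?_) s).trans ?_
    · rw [inv_mul_norm_sq]
      exact pow_le_pow_left₀ (norm_nonneg _) (h3 j) 2
    · have hne : hat (D.g j) γ ≠ 0 := fun h0 => hj (by rw [h0]; simp)
      obtain ⟨i', hi', h4, h5⟩ := h1 j hne
      obtain rfl := D.eq_of_mem_Sband hγ h4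
      refine Finset.mem_image.2 ⟨_, Finset.mem_Icc.2 ?_, D.gen_φ _ ⟨j, D.mem_Js hi'⟩⟩
      have := hm _ _ h5
      omega
    · gcongr
      refine Finset.card_image_le.trans ?_
      simp
  · refine (Finset.sum_nonpos fun j _ => ?_).trans (by positivity)
    by_contra hcon
    have hne : hat (D.g j) γ ≠ 0 := fun h0 => hcon (by rw [h0]; simp)
    obtain ⟨i, -, h4, -⟩ := h1 j hne
    exact hS (mem_iUnion.2 ⟨i, h4⟩)

theorem IsDualGenerators.ae_sum_norm_sq_hat_le [Countable J] (hdual : D.IsDualGenerators a h)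
    (hbdd : ∃ C : ℝ, ∀ (i : D.I) (k : ℤ), ∀ n ∈ Finset.Icc (-(D.N : ℤ) + 1) ((D.N : ℤ) - 1),
      ‖a i k n‖ ≤ C)
    (ha_zero : ∀ (i : D.I) (j : D.Js i), a i (D.φ i j) 0 = 1)
    (ha_sum : ∀ (i : D.I) (j : D.Js i), ∀ n ∈ Finset.Icc (1 : ℤ) ((D.N : ℤ) - 1),
      ((Real.sqrt (D.c (D.shift i j n) / D.c j) : ℝ) : ℂ) * a i (D.φ i j) n +
        ((Real.sqrt (D.c j / D.c (D.shift i j n)) : ℝ) : ℂ) * a i (D.φ i j + n) (-n) = 2) :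
    ∃ C : ℝ, ∀ᵐ γ : ℝ, ∀ s : Finset J, ∑ j ∈ s, (D.c j)⁻¹ * ‖hat (h j) γ‖ ^ 2 ≤ C := by
  classical
  obtain ⟨C, hC⟩ := D.hat_g_bounded
  obtain ⟨C', hC'⟩ := hbdd
  set R := Finset.Icc (-(D.N : ℤ) + 1) ((D.N : ℤ) - 1)
  -- If `ĥ` with index `k` is nonzero at `γ`, some `k + n` with `|n| < N` lies in `[m - N + 1, m]`,
  -- so `k` is among the `3N + 1` integers of `[m - 2N, m + N]`. Each normalized `ĥ` has `R.card`
  -- terms of size at most `(2 + C') C`.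
  refine ⟨(3 * D.N + 1 : ℕ) * (R.card * ((2 + C') * C)) ^ 2, ?_⟩
  filter_upwards [D.ae_mem_Icc_of_hat_ne_zero, D.ae_ne_knots, ae_all_iff.2 hC, hdual.ae]
    with γ h1 h2 h3 h4 s
  by_cases hS : γ ∈ D.S
  · obtain ⟨i, hγ⟩ := mem_iUnion.1 hS
    obtain ⟨m, hm⟩ := D.exists_knot_lt_lt hγ (h2 i).1 (h2 i).2
    refine (sum_le_card_mul_of_ne_zero
      (T := (Finset.Icc (m - 2 * D.N) (m + D.N)).image (D.gen i))
      (K := (R.card * ((2 + C') * C)) ^ 2)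
      (fun j => by have := D.c_pos j; positivity) (fun j => ?_) (fun j hj => ?_) s).trans ?_
    · by_cases hi : i ∈ D.Iact j
      · rw [inv_mul_norm_sq, normDual_eq_sum hi (((h4 j).2 i hγ).1 hi)]
        refine pow_le_pow_left₀ (norm_nonneg _) ?_ 2
        refine (norm_sum_le _ _).trans ?_
        rw [← nsmul_eq_mul]
        refine Finset.sum_le_card_nsmul _ _ _ fun n hn => ?_
        rw [norm_mul]
        have := norm_normCoeff_le hC' ha_zero ha_sum i (D.φ i ⟨j, D.mem_Js hi⟩) hn
        exact mul_le_mul this (h3 _) (norm_nonneg _) ((norm_nonneg _).trans this)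
      · rw [((h4 j).2 i hγ).2 hi]
        simp only [norm_zero, ne_eq, OfNat.ofNat_ne_zero, not_false_eq_true, zero_pow, mul_zero]
        positivity
    · have hne : hat (h j) γ ≠ 0 := fun h0 => hj (by rw [h0]; simp)
      have hi : i ∈ D.Iact j := by
        by_contra hi
        exact hne (((h4 j).2 i hγ).2 hi)
      rw [((h4 j).2 i hγ).1 hi] at hne
      obtain ⟨n, hn, hne⟩ := Finset.exists_ne_zero_of_sum_ne_zero hne
      have h5 := (D.mem_Icc_of_hat_gen_ne_zero h1 hγ (right_ne_zero_of_mul hne)).2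
      refine Finset.mem_image.2 ⟨_, Finset.mem_Icc.2 ?_, D.gen_φ _ ⟨j, D.mem_Js hi⟩⟩
      have := hm _ _ h5
      rw [Finset.mem_Icc] at hn
      omega
    · gcongr
      refine Finset.card_image_le.trans ?_
      rw [Int.card_Icc]
      omega
  · refine (Finset.sum_nonpos fun j _ => ?_).trans (by positivity)
    rw [(h4 j).1 hS]
    simp

/-- The duality condition for the diagonal terms of the frame operator. -/
theorem IsDualGenerators.ae_hasSum [Countable J] (hdual : D.IsDualGenerators a h)
    (hunity : ∀ᵐ γ : ℝ, HasSum (fun j => (((Real.sqrt (D.c j))⁻¹ : ℝ) : ℂ) * hat (D.g j) γ)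
      (D.S.indicator (fun _ => (1 : ℂ)) γ))
    (ha_zero : ∀ (i : D.I) (j : D.Js i), a i (D.φ i j) 0 = 1)
    (ha_sum : ∀ (i : D.I) (j : D.Js i), ∀ n ∈ Finset.Icc (1 : ℤ) ((D.N : ℤ) - 1),
      ((Real.sqrt (D.c (D.shift i j n) / D.c j) : ℝ) : ℂ) * a i (D.φ i j) n +
        ((Real.sqrt (D.c j / D.c (D.shift i j n)) : ℝ) : ℂ) * a i (D.φ i j + n) (-n) = 2) :
    ∀ᵐ γ : ℝ, γ ∈ D.S →
      HasSum (fun j => (((D.c j)⁻¹ : ℝ) : ℂ) * (conj (hat (D.g j) γ) * hat (h j) γ)) 1 := by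
  filter_upwards [D.ae_mem_Icc_of_hat_ne_zero, D.ae_ne_knots, ae_all_iff.2 D.hat_g_real, hdual.ae,
    hunity] with γ h1 h2 h3 h4 h5 hS
  obtain ⟨i, hγ⟩ := mem_iUnion.1 hS
  obtain ⟨m, hm⟩ := D.exists_knot_lt_lt hγ (h2 i).1 (h2 i).2
  rw [indicator_of_mem hS] at h5
  have hz : ∀ j, j ∉ D.Js i → hat (D.g j) γ = 0 := by
    intro j hj
    by_contra hne
    obtain ⟨i', hi', h6, -⟩ := h1 j hne
    obtain rfl := D.eq_of_mem_Sband hγ h6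
    exact hj (D.mem_Js hi')
  have hG : ∀ k, k ∉ Finset.Icc (m - D.N + 1) m → D.normGen i γ k = 0 := by
    intro k hk
    by_contra hne
    have := hm _ _ (D.mem_Icc_of_hat_gen_ne_zero h1 hγ (right_ne_zero_of_mul hne)).2
    rw [Finset.mem_Icc] at hk
    omega
  have hsum : ∑ k ∈ Finset.Icc (m - D.N + 1) m, D.normGen i γ k = 1 :=
    (hasSum_sum_of_ne_finset_zero hG).unique
      ((D.hasSum_gen_iff (f := fun j => (((Real.sqrt (D.c j))⁻¹ : ℝ) : ℂ) * hat (D.g j) γ)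
        fun j hj => by rw [hz j hj, mul_zero]).2 h5)
  have key := sum_mul_shift_eq_one (x := D.normCoeff a i) hG hsum (normCoeff_zero ha_zero i)
    fun k n hn => normCoeff_add ha_sum i k hn
  refine (D.hasSum_gen_iff (i := i)
    (f := fun j => (((D.c j)⁻¹ : ℝ) : ℂ) * (conj (hat (D.g j) γ) * hat (h j) γ))
    fun j hj => by rw [hz j hj, map_zero, zero_mul, mul_zero]).1 ?_
  have e : ∀ k, (((D.c (D.gen i k))⁻¹ : ℝ) : ℂ) *
      (conj (hat (D.g (D.gen i k)) γ) * hat (h (D.gen i k)) γ) =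
      D.normGen i γ k * ∑ n ∈ Finset.Icc (-(D.N : ℤ) + 1) (D.N - 1),
        D.normCoeff a i k n * D.normGen i γ (k + n) := by
    intro k
    -- Where `ĝ` vanishes both sides are zero; elsewhere the band is active and the formula for `ĥ`
    -- is available.
    by_cases h0 : hat (D.g (D.gen i k)) γ = 0
    · simp [normGen, h0]
    have hi := (D.mem_Icc_of_hat_gen_ne_zero h1 hγ h0).1
    have h6 := normDual_eq_sum hi (((h4 _).2 i hγ).1 hi)
    rw [φ_gen] at h6
    rw [← h6, normGen, Complex.conj_eq_iff_im.2 (h3 _)]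
    have h7 : (((D.c (D.gen i k))⁻¹ : ℝ) : ℂ) = (((Real.sqrt (D.c (D.gen i k)))⁻¹ : ℝ) : ℂ) *
        (((Real.sqrt (D.c (D.gen i k)))⁻¹ : ℝ) : ℂ) := by
      rw [← Complex.ofReal_mul, ← mul_inv, Real.mul_self_sqrt (D.c_pos _).le]
    rw [h7]
    ring
  have h8 := hasSum_sum_of_ne_finset_zero (L := SummationFilter.unconditional ℤ)
    (f := fun k => D.normGen i γ k *
    ∑ n ∈ Finset.Icc (-(D.N : ℤ) + 1) (D.N - 1), D.normCoeff a i k n * D.normGen i γ (k + n))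
    (s := Finset.Icc (m - D.N + 1) m) fun k hk => by rw [hG k hk, zero_mul]
  rw [key] at h8
  exact h8.congr_fun e

theorem g_mem_bandL2 [Countable J] (j : J) : D.g j ∈ bandL2 D.S := by
  change ∀ᵐ γ : ℝ, γ ∉ D.S → hat (D.g j) γ = 0
  filter_upwards [D.ae_mem_Icc_of_hat_ne_zero] with γ h1 hS
  by_contra hne
  obtain ⟨i, -, h4, -⟩ := h1 j hne
  exact hS (mem_iUnion.2 ⟨i, h4⟩)

end GSISetup

theorem mainTheorem4 {J : Type*} [Countable J] (D : GSISetup J)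
    (a : D.I → ℤ → ℤ → ℂ) (h : J → L2R) (hdual : D.IsDualGenerators a h)
    (hunity : ∀ᵐ γ : ℝ, HasSum (fun j => (((Real.sqrt (D.c j))⁻¹ : ℝ) : ℂ) * hat (D.g j) γ)
      (D.S.indicator (fun _ => (1 : ℂ)) γ))
    (hc : ∀ (j : J) (p q : D.I) (hp : IsLeast (D.Iact j) p) (hq : IsGreatest (D.Iact j) q),
      D.c j ≤ 1 / D.M j p q hp hq)
    (hbdd : ∃ C : ℝ, ∀ (i : D.I) (k : ℤ), ∀ n ∈ Finset.Icc (-(D.N : ℤ) + 1) ((D.N : ℤ) - 1),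
      ‖a i k n‖ ≤ C)
    (ha_zero : ∀ (i : D.I) (j : D.Js i), a i (D.φ i j) 0 = 1)
    (ha_sum : ∀ (i : D.I) (j : D.Js i), ∀ n ∈ Finset.Icc (1 : ℤ) ((D.N : ℤ) - 1),
      ((Real.sqrt (D.c (D.shift i j n) / D.c j) : ℝ) : ℂ) * a i (D.φ i j) n +
        ((Real.sqrt (D.c j / D.c (D.shift i j n)) : ℝ) : ℂ) * a i (D.φ i j + n) (-n) = 2) :
    AreDualFrames (bandL2 D.S) (gsi D.c D.g) (gsi D.c h) := by
  choose A B hle hlen hgs hhs using D.exists_support_intervals hdual hc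
  obtain ⟨C₁, h₁⟩ := D.ae_sum_norm_sq_hat_g_le
  obtain ⟨C₂, h₂⟩ := hdual.ae_sum_norm_sq_hat_le hbdd ha_zero ha_sum
  -- The 1 makes the common bound positive.
  refine areDualFrames_gsi (C := max 1 (max C₁ C₂)) D.c_pos (by positivity) hle hlen hgs hhs
    GSISetup.g_mem_bandL2 (fun j => (hdual j).1) ?_ ?_
    (hdual.ae_hasSum hunity ha_zero ha_sum)
  · filter_upwards [h₁] with γ h s
    exact (h s).trans ((le_max_left _ _).trans (le_max_right _ _))
  · filter_upwards [h₂] with γ h s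
    exact (h s).trans ((le_max_right _ _).trans (le_max_right _ _))
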